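/- For a poset $X$ and $k\ge 0$ let $H_k(X,\mathbb Z)$ be the $k$-th homology group of the complex $C_\bullet(X,\mathbb Z)$, where $C_k(X,\mathbb Z)$ is the free abelian group on the chains $x_0<\dots<x_k$ in $X$ and $\partial=\sum_i(-1)^i d_i$ with $d_i$ omitting $x_i$; this is the integral homology of the geometric realization $|X|$. An order-preserving map $f\colon X\to Y$ of posets induces $f_*\colon H_k(X,\mathbb Z)\to H_k(Y,\mathbb Z)$, given on chains by $(x_0<\dots<x_k)\mapsto(f(x_0)<\dots<f(x_k))$ if the $f(x_i)$ are distinct, and by $0$ otherwise. For $X\neq\varnothing$ and $k\ge 0$ put $\tilde H_k(X,\mathbb Z)=\ker\big(H_k(X,\mathbb Z)\to H_k(\mathrm{pt},\mathbb Z)\big)$. For an integer $m\ge -1$, a poset $X$ is called $m$-acyclic if it is nonempty and $\tilde H_k(X,\mathbb Z)=0$ for $0\le k\le m$; for $m<-1$ every poset is $m$-acyclic. Theorem. Let $f\colon X\to Y$ be an order-preserving map of posets, let $\mathrm{ht}_Y\colon Y\to\mathbb Z_{\ge 0}$ be a height function, i.e. a strictly increasing map, and let $n$ be an integer. Assume that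 for every $y\in Y$ the subposet $\mathrm{Link}^+_Y(y)=\{u\in Y: u>y\}$ is $(n-\mathrm{ht}_Y(y)-2)$-acyclic and the subposet $f/y=\{x\in X: f(x)\le y\}$ is $(\mathrm{ht}_Y(y)-1)$-acyclic. Then $f_*\colon H_k(X,\mathbb Z)\to H_k(Y,\mathbb Z)$ is an isomorphism for all $0\le k\le n-1$. -/

import Mathlib

open CategoryTheory

universe u

namespace PosetHomology

/-- The `n`-simplices of (the simplicial complex of) a poset `X`: the tuples `x₀ < ⋯ < xₙ`. -/
abbrev Simplex (X : Type u) [PartialOrder X] (n : ℕ) : Type u :=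
  {s : Fin (n + 1) → X // StrictMono s}

/-- The `i`-th face `x₀ < ⋯ < x̂ᵢ < ⋯ < xₙ₊₁` of an `(n + 1)`-simplex. -/
def Simplex.face {X : Type u} [PartialOrder X] {n : ℕ} (s : Simplex X (n + 1))
    (i : Fin (n + 2)) : Simplex X n :=
  ⟨s.1 ∘ i.succAbove, s.2.comp (Fin.strictMono_succAbove i)⟩

/-- The group `Cₙ(X, ℤ)`: the free abelian group on the `n`-simplices of `X`. -/
abbrev Chains (X : Type u) [PartialOrder X] (n : ℕ) : Type u := Simplex X n →₀ ℤ

/-- The differential `∂ = ∑ᵢ (-1)ⁱ dᵢ`, where `dᵢ` omits the `i`-th vertex. -/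
noncomputable def boundary (X : Type u) [PartialOrder X] (n : ℕ) :
    Chains X (n + 1) →ₗ[ℤ] Chains X n :=
  Finsupp.linearCombination ℤ fun s : Simplex X (n + 1) =>
    ∑ i : Fin (n + 2), (-1 : ℤ) ^ (i : ℕ) • Finsupp.single (s.face i) (1 : ℤ)

open Classical in
/-- The chain of a tuple of elements of `X`: the simplex `t` if `t` is strictly increasing,
and `0` otherwise (in particular if `t` is increasing with a repeated vertex). -/
noncomputable def tupleChain {X : Type u} [PartialOrder X] {n : ℕ} (t : Fin (n + 1) → X) :
    Chains X n :=
  if h : StrictMono t then Finsupp.single ⟨t, h⟩ 1 else 0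

/-- The map on chains induced by a poset map: `(x₀ < ⋯ < xₙ)` goes to
`(f x₀ < ⋯ < f xₙ)`, or to `0` if two of the `f xᵢ` coincide. -/
noncomputable def chainsMap {X Y : Type u} [PartialOrder X] [PartialOrder Y] (f : X →o Y)
    (n : ℕ) : Chains X n →ₗ[ℤ] Chains Y n :=
  Finsupp.linearCombination ℤ fun s : Simplex X n => tupleChain (f ∘ s.1)

theorem boundary_single {X : Type u} [PartialOrder X] (n : ℕ) (s : Simplex X (n + 1)) :
    boundary X n (Finsupp.single s 1) =
      ∑ i : Fin (n + 2), (-1 : ℤ) ^ (i : ℕ) • Finsupp.single (s.face i) (1 : ℤ) := by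
  simp [boundary]

theorem chainsMap_single {X Y : Type u} [PartialOrder X] [PartialOrder Y] (f : X →o Y)
    (n : ℕ) (s : Simplex X n) :
    chainsMap f n (Finsupp.single s 1) = tupleChain (f ∘ s.1) := by
  simp [chainsMap]

theorem face_face {X : Type u} [PartialOrder X] {n : ℕ} (s : Simplex X (n + 2))
    {i j : Fin (n + 2)} (h : i ≤ j) :
    (s.face j.succ).face i = (s.face i.castSucc).face j := by
  apply Subtype.ext
  funext k
  simp only [Simplex.face, Function.comp]
  refine congrArg s.1 (Fin.ext ?_)
  simp only [Fin.succAbove, Fin.lt_def, Fin.le_def] at *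
  split_ifs <;> simp_all <;> omega

theorem boundary_comp_boundary (X : Type u) [PartialOrder X] (n : ℕ) :
    boundary X n ∘ₗ boundary X (n + 1) = 0 := by
  refine Finsupp.lhom_ext' fun s => LinearMap.ext_ring ?_
  simp only [LinearMap.comp_apply, Finsupp.lsingle_apply, boundary_single, map_sum, map_smul,
    LinearMap.zero_apply, Finset.smul_sum, smul_smul, ← pow_add]
  rw [← Finset.sum_product']
  let P := Fin (n + 3) × Fin (n + 2)
  let S : Finset P := {ij : P | (ij.1 : ℕ) ≤ (ij.2 : ℕ)}
  rw [Finset.univ_product_univ, ← Finset.sum_add_sum_compl S, ← eq_neg_iff_add_eq_zero,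
    ← Finset.sum_neg_distrib]
  let φ : ∀ ij : P, ij ∈ S → P := fun ij hij =>
    (Fin.succ ij.2, Fin.castLT ij.1 (lt_of_le_of_lt (Finset.mem_filter.mp hij).right ij.2.isLt))
  apply Finset.sum_bij φ
  · intro ij hij
    simp only [S, Finset.mem_univ, Finset.compl_filter, Finset.mem_filter, true_and,
      Fin.val_succ, Fin.val_castLT, φ] at hij ⊢
    omega
  · rintro ⟨i, j⟩ hij ⟨i', j'⟩ hij' h
    have h1 := congrArg (fun p : P => (p.1 : ℕ)) h
    have h2 := congrArg (fun p : P => (p.2 : ℕ)) h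
    simp only [φ, Fin.val_succ, Fin.val_castLT] at h1 h2
    exact Prod.ext (Fin.ext h2) (Fin.ext (by simpa using h1))
  · rintro ⟨i', j'⟩ hij'
    simp only [S, Finset.mem_univ, Finset.compl_filter, Finset.mem_filter, true_and,
      not_le] at hij'
    refine ⟨(j'.castSucc, i'.pred ?_), ?_, ?_⟩
    · rintro rfl
      simp at hij'
    · simp only [S, Finset.mem_univ, Finset.mem_filter, true_and, Fin.val_castSucc,
        Fin.val_pred]
      omega
    · simp [φ]
  · rintro ⟨i, j⟩ hij
    have hij2 : (i : ℕ) ≤ j := by simpa [S] using hij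
    have hi : (i : ℕ) < n + 2 := lt_of_le_of_lt hij2 j.isLt
    have hf := face_face s (i := i.castLT hi) (j := j) (by simpa [Fin.le_def] using hij2)
    simp only [Fin.castSucc_castLT] at hf
    simp only [φ, Fin.val_succ, Fin.val_castLT, hf, ← neg_smul]
    congr 1
    ring

theorem boundary_tupleChain {X : Type u} [PartialOrder X] {n : ℕ} (t : Fin (n + 2) → X)
    (ht : Monotone t) :
    boundary X n (tupleChain t) =
      ∑ i : Fin (n + 2), (-1 : ℤ) ^ (i : ℕ) • tupleChain (t ∘ i.succAbove) := by
  by_cases h : StrictMono t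
  · rw [tupleChain, dif_pos h, boundary_single]
    refine Finset.sum_congr rfl fun i _ => ?_
    rw [tupleChain, dif_pos (h.comp (Fin.strictMono_succAbove i))]
    rfl
  · rw [tupleChain, dif_neg h, map_zero]
    rw [Fin.strictMono_iff_lt_succ] at h
    push Not at h
    obtain ⟨i, hi⟩ := h
    have hi' : t i.castSucc = t i.succ := by
      by_contra hne
      exact hi (lt_of_le_of_ne (ht (Fin.castSucc_lt_succ (i := i)).le) hne)
    have hne : i.castSucc ≠ i.succ := (Fin.castSucc_lt_succ (i := i)).ne
    symm
    rw [Finset.sum_eq_add i.castSucc i.succ hne]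
    · have hEq : t ∘ i.castSucc.succAbove = t ∘ i.succ.succAbove := by
        funext k
        by_cases hk : k = i
        · subst hk
          simp [hi']
        · refine congrArg t (Fin.ext ?_)
          have hk' : (k : ℕ) ≠ i := fun h => hk (Fin.ext h)
          simp only [Fin.succAbove, Fin.lt_def, Fin.val_castSucc, Fin.val_succ]
          split_ifs <;> simp only [Fin.val_castSucc, Fin.val_succ] <;> omega
      rw [hEq, ← add_smul]
      simp [pow_succ]
    · rintro c - ⟨hc1, hc2⟩
      obtain ⟨a, ha⟩ := Fin.exists_succAbove_eq hc1.symm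
      obtain ⟨b, hb⟩ := Fin.exists_succAbove_eq hc2.symm
      have : ¬ StrictMono (t ∘ c.succAbove) := by
        intro hs
        have hab : a = b := hs.injective (by simp [ha, hb, hi'])
        exact hne (by rw [← ha, ← hb, hab])
      rw [tupleChain, dif_neg this, smul_zero]
    · intro h; exact absurd (Finset.mem_univ _) h
    · intro h; exact absurd (Finset.mem_univ _) h

theorem chainsMap_comp_boundary {X Y : Type u} [PartialOrder X] [PartialOrder Y] (f : X →o Y)
    (n : ℕ) :
    boundary Y n ∘ₗ chainsMap f (n + 1) = chainsMap f n ∘ₗ boundary X n := by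
  refine Finsupp.lhom_ext' fun s => LinearMap.ext_ring ?_
  simp only [LinearMap.comp_apply, Finsupp.lsingle_apply, boundary_single, chainsMap_single,
    map_sum, map_smul]
  rw [boundary_tupleChain _ (f.monotone.comp s.2.monotone)]
  rfl

/-- The complex `C_•(X, ℤ)` of a poset, with `Cₙ(X, ℤ) = ⨁_{x₀ < ⋯ < xₙ} ℤ`. -/
noncomputable def chainComplex (X : Type u) [PartialOrder X] :
    ChainComplex (ModuleCat.{u} ℤ) ℕ :=
  ChainComplex.of (fun n => ModuleCat.of ℤ (Chains X n)) (fun n => ModuleCat.ofHom (boundary X n))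
    (fun n => by rw [← ModuleCat.ofHom_comp, boundary_comp_boundary]; rfl)

/-- The chain map `C_•(X, ℤ) → C_•(Y, ℤ)` induced by a poset map. -/
noncomputable def chainComplexMap {X Y : Type u} [PartialOrder X] [PartialOrder Y] (f : X →o Y) :
    chainComplex X ⟶ chainComplex Y :=
  ChainComplex.ofHom (fun n => ModuleCat.ofHom (chainsMap f n)) fun n => by
    simp only [chainComplex, ChainComplex.of_d]
    exact congrArg ModuleCat.ofHom (chainsMap_comp_boundary f n)

/-- The homology group `H_k(X, ℤ)` of a poset. -/
noncomputable abbrev homology (X : Type u) [PartialOrder X] (k : ℕ) : ModuleCat.{u} ℤ :=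
  (chainComplex X).homology k

/-- The map `f_* : H_k(X, ℤ) → H_k(Y, ℤ)` induced by a poset map. -/
noncomputable abbrev homologyMap {X Y : Type u} [PartialOrder X] [PartialOrder Y] (f : X →o Y)
    (k : ℕ) : homology X k ⟶ homology Y k :=
  HomologicalComplex.homologyMap (chainComplexMap f) k

/-- For a nonempty poset `X` and `k ≥ 0`, the reduced homology group
`H̃_k(X, ℤ) = ker (H_k(X, ℤ) → H_k(pt, ℤ))`. -/
noncomputable def reducedHomology (X : Type u) [PartialOrder X] (k : ℕ) :
    Submodule ℤ (homology X k) :=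
  LinearMap.ker (homologyMap (OrderHom.const X PUnit.unit.{u + 1}) k).hom

/-- A poset `X` is `m`-acyclic if it is nonempty and `H̃_k(X, ℤ) = 0` for `0 ≤ k ≤ m`;
for `m < -1` the condition is vacuous. -/
def IsAcyclic (X : Type u) [PartialOrder X] (m : ℤ) : Prop :=
  -1 ≤ m → Nonempty X ∧ ∀ k : ℕ, (k : ℤ) ≤ m → reducedHomology X k = ⊥

/-- `Link⁺_X(x) = {u ∈ X : u > x}`. -/
def linkAbove {X : Type u} [PartialOrder X] (x : X) : Set X := {u | u > x}

/-- `f/y = {x ∈ X : f(x) ≤ y}`. -/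
def fiberBelow {X Y : Type u} [PartialOrder X] [PartialOrder Y] (f : X →o Y) (y : Y) : Set X :=
  {x | f x ≤ y}

end PosetHomology

/-!
A version, for posets with a height function, of Quillen's theorem on the fibres of a map of
posets. Let `M` be the mapping cylinder of `f`: the poset `X ⊔ Y` in which `x < y` if and only if
`f x ≤ y`. It contains `X`, and it retracts onto `Y` by a map that restricts to `f` on `X`. So the
theorem follows from two facts: the homology of `M` relative to `X` vanishes in degrees `≤ n`, and
the inclusion of `X` in `M` is homotopic to `f`. The second is the prism formula
(`joinBd_prism_single`).

For the first (`exists_sub_joinBd_mem`), a chain of `M` outside `X` has the form `a < y < b` with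
`y` the least element of its part in `Y`; here `a` is a chain in `f / y` and `b` one in
`Link⁺(y)`. With `y` fixed, these chains form the augmented complex of the join of `f / y` and
`Link⁺(y)`. The augmented complexes are free and exact in low degrees, hence contractible in these
degrees (`exists_contraction`), by homotopies `h` and `g`, say. The homotopy
`h ⊗ 1 + (1 - h ∂ - ∂ h) ⊗ g` (`joinHomotopy`) then contracts the complex of the join in the range
needed, since the bounds of acyclicity of `f / y` and of `Link⁺(y)` add up. In the complex of `M`
relative to `X` this fails only by terms in which `y` is omitted, so that the least element of the
part in `Y` moves up. Iterating pushes every relative cycle into `X`. This stops although heights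
may be unbounded: once the height of `y` is `≥ n`, the factor `1 - h ∂ - ∂ h` vanishes for
reasons of degree, `g` no longer intervenes, and the part in `Y` gets shorter (`weight`,
`sub_joinHomotopy_single_mem`).

Chains are written as formal combinations of lists, with the augmented differential defined by
`∂ (x :: l) = l - x :: ∂ l`. All posets that occur are treated inside the free groups on lists in
`X` and in `Y`, as the spans of suitable sets of lists, and most identities are inductions on
lists. The comparison with the complexes `C_•(-, ℤ)` is `toListChains`.
-/

namespace PosetHomology

/-! ### Homology classes in terms of chains -/

section HomologyElements

variable {R : Type*} [Ring R] {K L : ChainComplex (ModuleCat.{u} R) ℕ}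

theorem exists_homologyπ_eq (k : ℕ) (x : K.homology k) :
    ∃ z : K.cycles k, K.homologyπ k z = x :=
  (ModuleCat.epi_iff_surjective (K.homologyπ k)).1 inferInstance x

/-- In degree `0` the differential `K.d k (k - 1)` is `K.d 0 0 = 0`, so that its kernel consists
of the cycles in every degree. -/
theorem exists_iCycles_eq (k : ℕ) (x : K.X k) (hx : K.d k (k - 1) x = 0) :
    ∃ z : K.cycles k, K.iCycles k z = x := by
  have hn : (ComplexShape.down ℕ).next k = k - 1 := by
    cases k <;> simp
  have hx' : (K.sc k).g x = 0 := by
    change K.d k ((ComplexShape.down ℕ).next k) x = 0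
    rw [hn]; exact hx
  refine ⟨(K.sc k).moduleCatCyclesIso.inv ⟨x, hx'⟩, ?_⟩
  exact (K.sc k).moduleCatCyclesIso_inv_iCycles_apply ⟨x, hx'⟩

theorem d_iCycles_apply (k : ℕ) (z : K.cycles k) : K.d k (k - 1) (K.iCycles k z) = 0 := by
  have := K.iCycles_d k (k - 1)
  exact congr($this z)

theorem homologyπ_eq_zero_iff (k : ℕ) (z : K.cycles k) :
    K.homologyπ k z = 0 ↔ ∃ w : K.X (k + 1), K.d (k + 1) k w = K.iCycles k z := by
  constructor
  · intro h
    have hp : (ComplexShape.down ℕ).prev k = k + 1 := by simp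
    have hc := (K.sc k).π_moduleCatCyclesIso_hom_apply z
    have h' : (K.sc k).homologyπ z = 0 := h
    rw [h', map_zero] at hc
    obtain ⟨w, hw⟩ := (Submodule.Quotient.mk_eq_zero _).1 hc.symm
    have hw' : (K.sc k).f w = (K.sc k).iCycles z := by
      rw [← (K.sc k).moduleCatCyclesIso_hom_i_apply z, ← hw]; rfl
    have key : ∀ j, (ComplexShape.down ℕ).prev k = j →
        ∃ w : K.X j, K.d j k w = K.iCycles k z := by
      rintro j rfl
      exact ⟨w, hw'⟩
    exact key _ hp
  · rintro ⟨w, hw⟩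
    have : K.toCycles (k + 1) k w = z := by
      apply (ModuleCat.mono_iff_injective (K.iCycles k)).1 inferInstance
      rw [← hw]
      exact congr($(K.toCycles_i (k + 1) k) w)
    rw [← this]
    exact congr($(K.toCycles_comp_homologyπ (k + 1) k) w)

theorem iCycles_cyclesMap_apply (φ : K ⟶ L) (k : ℕ) (z : K.cycles k) :
    L.iCycles k (HomologicalComplex.cyclesMap φ k z) = φ.f k (K.iCycles k z) :=
  congr($(HomologicalComplex.cyclesMap_i φ k) z)

theorem homologyMap_homologyπ_apply (φ : K ⟶ L) (k : ℕ) (z : K.cycles k) :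
    HomologicalComplex.homologyMap φ k (K.homologyπ k z) =
      L.homologyπ k (HomologicalComplex.cyclesMap φ k z) :=
  congr($(HomologicalComplex.homologyπ_naturality φ k) z)

/-- A chain map induces an isomorphism on homology if every cycle of the target is homologous to
the image of a cycle, and every cycle whose image bounds is a boundary. -/
theorem isIso_homologyMap_of_chains (φ : K ⟶ L) (k : ℕ)
    (hsurj : ∀ z : L.X k, L.d k (k - 1) z = 0 → ∃ w : K.X k, K.d k (k - 1) w = 0 ∧
      ∃ v : L.X (k + 1), L.d (k + 1) k v = φ.f k w - z)
    (hinj : ∀ w : K.X k, K.d k (k - 1) w = 0 →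
      (∃ v : L.X (k + 1), L.d (k + 1) k v = φ.f k w) → ∃ u : K.X (k + 1), K.d (k + 1) k u = w) :
    IsIso (HomologicalComplex.homologyMap φ k) := by
  have hm : Mono (HomologicalComplex.homologyMap φ k) := by
    rw [ModuleCat.mono_iff_injective, injective_iff_map_eq_zero]
    intro x hx
    obtain ⟨z, rfl⟩ := exists_homologyπ_eq k x
    rw [homologyMap_homologyπ_apply, homologyπ_eq_zero_iff] at hx
    rw [homologyπ_eq_zero_iff]
    refine hinj _ (d_iCycles_apply k z) ?_
    rwa [iCycles_cyclesMap_apply] at hx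
  have he : Epi (HomologicalComplex.homologyMap φ k) := by
    rw [ModuleCat.epi_iff_surjective]
    intro x
    obtain ⟨z, rfl⟩ := exists_homologyπ_eq k x
    obtain ⟨w, hw, v, hv⟩ := hsurj _ (d_iCycles_apply k z)
    obtain ⟨w, rfl⟩ := exists_iCycles_eq k w hw
    refine ⟨K.homologyπ k w, ?_⟩
    rw [homologyMap_homologyπ_apply, ← sub_eq_zero, ← map_sub, homologyπ_eq_zero_iff]
    exact ⟨v, by rw [map_sub, iCycles_cyclesMap_apply, hv]⟩
  exact isIso_of_mono_of_epi _

end HomologyElements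

theorem chainComplex_d_apply {X : Type u} [PartialOrder X] (k : ℕ) (c : Chains X (k + 1)) :
    (chainComplex X).d (k + 1) k c = boundary X k c := by
  simp only [chainComplex, ChainComplex.of_d]
  rfl

theorem isIso_homologyMap {X Y : Type u} [PartialOrder X] [PartialOrder Y] (f : X →o Y) (k : ℕ)
    (hsurj : ∀ z : Chains Y k, (chainComplex Y).d k (k - 1) z = 0 →
      ∃ w : Chains X k, (chainComplex X).d k (k - 1) w = 0 ∧
        ∃ v : Chains Y (k + 1), boundary Y k v = chainsMap f k w - z)
    (hinj : ∀ w : Chains X k, (chainComplex X).d k (k - 1) w = 0 →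
      ∀ v : Chains Y (k + 1), boundary Y k v = chainsMap f k w →
        ∃ u : Chains X (k + 1), boundary X k u = w) :
    IsIso (homologyMap f k) := by
  refine isIso_homologyMap_of_chains _ k (fun z hz => ?_) fun w hw ⟨v, hv⟩ => ?_
  · obtain ⟨w, hw, v, hv⟩ := hsurj z hz
    exact ⟨w, hw, v, (chainComplex_d_apply k v).trans hv⟩
  · obtain ⟨u, hu⟩ := hinj w hw v ((chainComplex_d_apply k v).symm.trans hv)
    exact ⟨u, (chainComplex_d_apply k u).trans hu⟩

/-- Acyclicity in terms of chains. In degree `0` the vanishing of the augmentation is expressed by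
saying that the chain maps to zero in the complex of a point. -/
theorem IsAcyclic.exists_boundary_eq {X : Type u} [PartialOrder X] {m : ℤ} (h : IsAcyclic X m)
    (k : ℕ) (hk : (k : ℤ) ≤ m) (c : Chains X k) (hc : (chainComplex X).d k (k - 1) c = 0)
    (hc0 : chainsMap (OrderHom.const X PUnit.unit.{u + 1}) k c = 0) :
    ∃ w : Chains X (k + 1), boundary X k w = c := by
  have hr := (h (by omega)).2 k hk
  obtain ⟨z, hz⟩ := exists_iCycles_eq (K := chainComplex X) k c hc
  have hmem : (chainComplex X).homologyπ k z ∈ reducedHomology X k := by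
    change homologyMap (OrderHom.const X PUnit.unit.{u + 1}) k _ = 0
    rw [homologyMap_homologyπ_apply, homologyπ_eq_zero_iff]
    refine ⟨0, ?_⟩
    rw [iCycles_cyclesMap_apply, hz, map_zero]
    exact hc0.symm
  rw [hr, Submodule.mem_bot, homologyπ_eq_zero_iff] at hmem
  obtain ⟨w, hw⟩ := hmem
  exact ⟨w, (chainComplex_d_apply k w).symm.trans (hw.trans hz)⟩

/-! ### The augmented complex of lists -/

section ListChains

variable {S T : Type*}

/-- The free abelian group on the lists in `T`. -/
abbrev ListChains (T : Type*) : Type _ := List T →₀ ℤ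

/-- A linear map on the span of `s` takes values in `N` as soon as it does so on the generators. -/
theorem map_mem_of_mem_supported {A B : Type*} [AddCommGroup B] (φ : (A →₀ ℤ) →ₗ[ℤ] B)
    {s : Set A} {N : Submodule ℤ B} (h : ∀ a ∈ s, φ (Finsupp.single a 1) ∈ N)
    {c : A →₀ ℤ} (hc : c ∈ Finsupp.supported ℤ ℤ s) : φ c ∈ N := by
  rw [Finsupp.supported_eq_span_single] at hc
  induction hc using Submodule.span_induction with
  | mem x hx => obtain ⟨a, ha, rfl⟩ := hx; exact h a ha
  | zero => simp
  | add x y _ _ hx hy => rw [map_add]; exact N.add_mem hx hy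
  | smul r x _ hx => rw [map_smul]; exact N.smul_mem r hx

theorem eqOn_of_mem_supported {A B : Type*} [AddCommGroup B] {φ ψ : (A →₀ ℤ) →ₗ[ℤ] B}
    {s : Set A} (h : ∀ a ∈ s, φ (Finsupp.single a 1) = ψ (Finsupp.single a 1))
    {c : A →₀ ℤ} (hc : c ∈ Finsupp.supported ℤ ℤ s) : φ c = ψ c := by
  have := map_mem_of_mem_supported (φ - ψ) (N := ⊥)
    (fun a ha => by simp [h a ha]) hc
  simpa [sub_eq_zero] using this

theorem single_one_mem_supported {A : Type*} {s : Set A} {a : A} (h : a ∈ s) :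
    Finsupp.single a (1 : ℤ) ∈ Finsupp.supported ℤ ℤ s :=
  Finsupp.single_mem_supported ℤ 1 h

theorem mem_supported_of_imp {A : Type*} {s t : Set A} (h : ∀ a ∈ s, a ∈ t) {c : A →₀ ℤ}
    (hc : c ∈ Finsupp.supported ℤ ℤ s) : c ∈ Finsupp.supported ℤ ℤ t :=
  Finsupp.supported_mono h hc

/-- Prepending `x` to every list. -/
noncomputable def consMap (x : T) : ListChains T →ₗ[ℤ] ListChains T :=
  Finsupp.lmapDomain ℤ ℤ (List.cons x)

@[simp] theorem consMap_single (x : T) (l : List T) (r : ℤ) :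
    consMap x (Finsupp.single l r) = Finsupp.single (x :: l) r := by
  simp [consMap]

/-- The boundary of a list: the alternating sum of the lists with one entry omitted. The boundary
of a singleton is the empty list, so this is the *augmented* differential. -/
noncomputable def listBoundary : List T → ListChains T
  | [] => 0
  | x :: l => Finsupp.single l 1 - consMap x (listBoundary l)

/-- The linear extension of `listBoundary`. -/
noncomputable def bd : ListChains T →ₗ[ℤ] ListChains T :=
  Finsupp.linearCombination ℤ listBoundary

@[simp] theorem bd_single_nil : bd (Finsupp.single ([] : List T) 1) = 0 := by
  simp [bd, listBoundary]

theorem bd_single_cons (x : T) (l : List T) :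
    bd (Finsupp.single (x :: l) 1) =
      Finsupp.single l 1 - consMap x (bd (Finsupp.single l 1)) := by
  simp [bd, listBoundary]

theorem bd_consMap (x : T) (c : ListChains T) : bd (consMap x c) = c - consMap x (bd c) := by
  have : bd ∘ₗ consMap x = LinearMap.id - consMap x ∘ₗ bd :=
    Finsupp.lhom_ext' fun l => LinearMap.ext_ring (by simp [bd_single_cons])
  exact congr($this c)

theorem bd_bd (c : ListChains T) : bd (bd c) = 0 := by
  have : bd ∘ₗ bd = (0 : ListChains T →ₗ[ℤ] ListChains T) := by
    refine Finsupp.lhom_ext' fun l => LinearMap.ext_ring ?_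
    simp only [LinearMap.comp_apply, Finsupp.lsingle_apply, LinearMap.zero_apply]
    induction l with
    | nil => simp
    | cons x l ih => rw [bd_single_cons, map_sub, bd_consMap, ih]; simp
  exact congr($this c)

theorem bd_single_mem (l : List T) : bd (Finsupp.single l 1) ∈
    Finsupp.supported ℤ ℤ {l' : List T | l'.Sublist l ∧ l'.length + 1 = l.length} := by
  induction l with
  | nil => simp
  | cons x l ih =>
    rw [bd_single_cons]
    refine Submodule.sub_mem _ ?_ ?_
    · refine single_one_mem_supported ?_
      exact ⟨List.sublist_cons_self x l, rfl⟩
    refine map_mem_of_mem_supported (consMap x) (fun l' hl' => ?_) ih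
    rw [consMap_single]
    refine single_one_mem_supported ?_
    exact ⟨hl'.1.cons_cons x, by have := hl'.2; simp only [List.length_cons]; omega⟩

theorem bd_single_ofFn {n : ℕ} (t : Fin (n + 1) → T) :
    bd (Finsupp.single (List.ofFn t) 1) =
      ∑ i : Fin (n + 1), (-1 : ℤ) ^ (i : ℕ) • Finsupp.single (List.ofFn (t ∘ i.succAbove)) 1 := by
  induction n with
  | zero => simp [bd_single_cons]
  | succ n ih =>
    rw [Fin.sum_univ_succ, List.ofFn_succ (f := t), bd_single_cons, ih, map_sum, sub_eq_add_neg,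
      ← Finset.sum_neg_distrib]
    congr 1
    · simp [Function.comp_def]
    · refine Finset.sum_congr rfl fun i _ => ?_
      rw [map_smul, consMap_single, List.ofFn_succ (f := t ∘ i.succ.succAbove), Fin.val_succ,
        pow_succ, mul_neg_one, neg_smul]
      simp [Function.comp_def]

/-- A family of lists closed under sublists whose augmented complex is exact in lengths `< s`
admits a contracting homotopy in these lengths. It is built by recursion on the length: if `h`
is defined on shorter lists, then `l - h (∂ l)` is a cycle, and `h l` is any filling of it. -/
theorem exists_contraction (C : Set (List T)) (hC : ∀ l ∈ C, ∀ l', l'.Sublist l → l' ∈ C) (s : ℕ)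
    (hex : ∀ p < s, ∀ c ∈ Finsupp.supported ℤ ℤ {l | l ∈ C ∧ l.length = p}, bd c = 0 →
      ∃ w ∈ Finsupp.supported ℤ ℤ {l | l ∈ C ∧ l.length = p + 1}, bd w = c) :
    ∃ h : ListChains T →ₗ[ℤ] ListChains T,
      (∀ l ∈ C, h (Finsupp.single l 1) ∈
        Finsupp.supported ℤ ℤ {l' | l' ∈ C ∧ l'.length = l.length + 1}) ∧
      ∀ l ∈ C, l.length < s →
        bd (h (Finsupp.single l 1)) + h (bd (Finsupp.single l 1)) = Finsupp.single l 1 := by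
  classical
  induction s with
  | zero => exact ⟨0, by simp, by simp⟩
  | succ s ih =>
    obtain ⟨h, hmem, hh⟩ := ih fun p hp => hex p (by omega)
    have hfill : ∀ l : List T, l ∈ C ∧ l.length = s →
        ∃ w ∈ Finsupp.supported ℤ ℤ {l | l ∈ C ∧ l.length = s + 1},
          bd w = Finsupp.single l 1 - h (bd (Finsupp.single l 1)) := by
      rintro l ⟨hl, rfl⟩
      have hb : bd (Finsupp.single l 1) ∈
          Finsupp.supported ℤ ℤ {l' | l' ∈ C ∧ l'.length + 1 = l.length} :=
        mem_supported_of_imp (fun l' h' => by exact ⟨hC l hl l' h'.1, h'.2⟩) (bd_single_mem l)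
      refine hex _ (by omega) _ ?_ ?_
      · refine Submodule.sub_mem _ (single_one_mem_supported ⟨hl, rfl⟩)
          (map_mem_of_mem_supported h (fun l' hl' => ?_) hb)
        exact mem_supported_of_imp (fun l'' h'' => by exact ⟨h''.1, h''.2.trans hl'.2⟩)
          (hmem l' hl'.1)
      · have : (bd ∘ₗ h + h ∘ₗ bd) (bd (Finsupp.single l 1)) =
            LinearMap.id (bd (Finsupp.single l 1)) :=
          eqOn_of_mem_supported
            (fun l' hl' => by simpa using hh l' hl'.1 (by have := hl'.2; omega)) hb
        simp only [LinearMap.add_apply, LinearMap.comp_apply, bd_bd, map_zero, add_zero,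
          LinearMap.id_apply] at this
        rw [map_sub, this, sub_self]
    choose! w hw hbw using hfill
    let h' : ListChains T →ₗ[ℤ] ListChains T := Finsupp.linearCombination ℤ fun l =>
      if l ∈ C ∧ l.length = s then w l else h (Finsupp.single l 1)
    have h'1 : ∀ l, l ∈ C ∧ l.length = s → h' (Finsupp.single l 1) = w l := fun l hl => by
      simp [h', hl]
    have h'2 : ∀ l, ¬ (l ∈ C ∧ l.length = s) → h' (Finsupp.single l 1) = h (Finsupp.single l 1) :=
      fun l hl => by simp only [h', Finsupp.linearCombination_single, if_neg hl, one_smul]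
    have hbd : ∀ l : List T, l.length ≤ s →
        h' (bd (Finsupp.single l 1)) = h (bd (Finsupp.single l 1)) := fun l hl =>
      eqOn_of_mem_supported (fun l' hl' => h'2 l' fun hc => by have := hl'.2; omega)
        (bd_single_mem l)
    refine ⟨h', fun l hl => ?_, fun l hl hlen => ?_⟩
    · by_cases hc : l ∈ C ∧ l.length = s
      · rw [h'1 l hc, hc.2]; exact hw l hc
      · rw [h'2 l hc]; exact hmem l hl
    · rw [hbd l (by omega)]
      by_cases hc : l ∈ C ∧ l.length = s
      · rw [h'1 l hc, hbw l hc]; simp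
      · rw [h'2 l hc]
        exact hh l hl (by have : l.length ≠ s := fun h => hc ⟨hl, h⟩; omega)

end ListChains

/-! ### The join and the relative homology of the mapping cylinder -/

section Join

variable {X Y : Type*}

/-- The free abelian group on pairs of lists. -/
abbrev PairChains (X Y : Type*) : Type _ := List X × List Y →₀ ℤ

/-- The bilinear map sending a pair of lists to the corresponding generator. -/
noncomputable def pair : ListChains X →ₗ[ℤ] ListChains Y →ₗ[ℤ] PairChains X Y :=
  Finsupp.linearCombination ℤ fun a => Finsupp.lmapDomain ℤ ℤ (Prod.mk a)

@[simp] theorem pair_single (a : List X) (b : List Y) :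
    pair (Finsupp.single a 1) (Finsupp.single b 1) = Finsupp.single (a, b) 1 := by
  simp [pair]

theorem pair_mem {s : Set (List X)} {t : Set (List Y)} {r : Set (List X × List Y)}
    (h : ∀ a ∈ s, ∀ b ∈ t, (a, b) ∈ r) {u : ListChains X} {v : ListChains Y}
    (hu : u ∈ Finsupp.supported ℤ ℤ s) (hv : v ∈ Finsupp.supported ℤ ℤ t) :
    pair u v ∈ Finsupp.supported ℤ ℤ r := by
  refine map_mem_of_mem_supported (pair.flip v) (fun a ha => ?_) hu
  refine map_mem_of_mem_supported (pair (Finsupp.single a 1)) (fun b hb => ?_) hv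
  rw [pair_single]
  exact single_one_mem_supported (h a ha b hb)

/-- The differential of the join: the alternating sum over the faces of the concatenation
of the two lists. As for lists, it is augmented. -/
noncomputable def joinBd : PairChains X Y →ₗ[ℤ] PairChains X Y :=
  Finsupp.linearCombination ℤ fun p =>
    pair (bd (Finsupp.single p.1 1)) (Finsupp.single p.2 1) +
      (-1 : ℤ) ^ p.1.length • pair (Finsupp.single p.1 1) (bd (Finsupp.single p.2 1))

/-- The chains on lists `l` whose length has parity `(-1) ^ l.length = ε`. -/
abbrev parityChains (X : Type*) (ε : ℤ) : Submodule ℤ (ListChains X) :=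
  Finsupp.supported ℤ ℤ {l : List X | (-1 : ℤ) ^ l.length = ε}

theorem bd_single_mem_parity (a : List X) :
    bd (Finsupp.single a 1) ∈ parityChains X (-(-1) ^ a.length) := by
  refine mem_supported_of_imp (fun l hl => ?_) (bd_single_mem a)
  have := hl.2
  change (-1) ^ l.length = _
  rw [← this, pow_succ]
  ring

/-- The Leibniz rule, with the sign given by the parity of the first factor. -/
theorem joinBd_pair {ε : ℤ} {u : ListChains X} (hu : u ∈ parityChains X ε) (v : ListChains Y) :
    joinBd (pair u v) = pair (bd u) v + ε • pair u (bd v) := by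
  refine eqOn_of_mem_supported (φ := joinBd ∘ₗ pair.flip v)
    (ψ := (pair.flip v) ∘ₗ bd + ε • pair.flip (bd v)) (fun a ha => ?_) hu
  obtain rfl : (-1 : ℤ) ^ a.length = ε := ha
  have : joinBd ∘ₗ pair (Finsupp.single a 1) = pair (Y := Y) (bd (Finsupp.single a 1)) +
      (-1 : ℤ) ^ a.length • (pair (Finsupp.single a 1) ∘ₗ bd) :=
    Finsupp.lhom_ext' fun b => LinearMap.ext_ring (by simp [joinBd])
  simpa using congr($this v)

theorem joinBd_single (a : List X) (b : List Y) :
    joinBd (Finsupp.single (a, b) 1) =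
      pair (bd (Finsupp.single a 1)) (Finsupp.single b 1) +
        (-1 : ℤ) ^ a.length • pair (Finsupp.single a 1) (bd (Finsupp.single b 1)) := by
  simp [joinBd]

theorem joinBd_joinBd (c : PairChains X Y) : joinBd (joinBd c) = 0 := by
  have : joinBd ∘ₗ joinBd = (0 : PairChains X Y →ₗ[ℤ] PairChains X Y) := by
    refine Finsupp.lhom_ext' fun p => LinearMap.ext_ring ?_
    obtain ⟨a, b⟩ := p
    simp only [LinearMap.comp_apply, Finsupp.lsingle_apply, LinearMap.zero_apply, joinBd_single,
      map_add, map_smul]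
    rw [joinBd_pair (bd_single_mem_parity a), joinBd_pair (ε := (-1) ^ a.length)
      (single_one_mem_supported rfl), bd_bd, bd_bd]
    simp
  exact congr($this c)

variable (h : Y → ListChains X →ₗ[ℤ] ListChains X) (g : Y → ListChains Y →ₗ[ℤ] ListChains Y)

/-- The defect `1 - h ∂ - ∂ h` of the contraction `h y`. -/
noncomputable def defect (y : Y) : ListChains X →ₗ[ℤ] ListChains X :=
  LinearMap.id - h y ∘ₗ bd - bd ∘ₗ h y

theorem defect_apply (y : Y) (u : ListChains X) :
    defect h y u = u - h y (bd u) - bd (h y u) := rfl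

theorem bd_defect (y : Y) (u : ListChains X) : bd (defect h y u) = defect h y (bd u) := by
  simp only [defect_apply, map_sub, bd_bd, map_zero, sub_zero]

/-- The homotopy on pairs of lists assembled from contractions `h y` of the complexes of `f / y`
and `g y` of the complexes of `Link⁺(y)`: on the pairs `(a, y :: b)` with `y` fixed it is the
tensor product homotopy `h ⊗ 1 + (1 - h ∂ - ∂ h) ⊗ g`, up to sign, and it vanishes on the
pairs `(a, [])`. -/
noncomputable def joinHomotopy : PairChains X Y →ₗ[ℤ] PairChains X Y :=
  Finsupp.linearCombination ℤ fun p => match p with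
    | (_, []) => 0
    | (a, y :: b) => pair (h y (Finsupp.single a 1)) (Finsupp.single (y :: b) 1) -
        (-1 : ℤ) ^ a.length •
          pair (defect h y (Finsupp.single a 1)) (consMap y (g y (Finsupp.single b 1)))

@[simp] theorem joinHomotopy_single_nil (a : List X) :
    joinHomotopy h g (Finsupp.single (a, []) 1) = 0 := by
  simp [joinHomotopy]

theorem joinHomotopy_single_cons (a : List X) (y : Y) (b : List Y) :
    joinHomotopy h g (Finsupp.single (a, y :: b) 1) =
      pair (h y (Finsupp.single a 1)) (Finsupp.single (y :: b) 1) -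
        (-1 : ℤ) ^ a.length •
          pair (defect h y (Finsupp.single a 1)) (consMap y (g y (Finsupp.single b 1))) := by
  simp [joinHomotopy]

theorem joinHomotopy_pair {ε : ℤ} {u : ListChains X} (hu : u ∈ parityChains X ε) (y : Y)
    (v : ListChains Y) :
    joinHomotopy h g (pair u (consMap y v)) =
      pair (h y u) (consMap y v) - ε • pair (defect h y u) (consMap y (g y v)) := by
  refine eqOn_of_mem_supported (φ := joinHomotopy h g ∘ₗ pair.flip (consMap y v))
    (ψ := (pair.flip (consMap y v)) ∘ₗ h y - ε • (pair.flip (consMap y (g y v))) ∘ₗ defect h y)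
    (fun a ha => ?_) hu
  obtain rfl : (-1 : ℤ) ^ a.length = ε := ha
  have : joinHomotopy h g ∘ₗ pair (Finsupp.single a 1) ∘ₗ consMap y =
      pair (h y (Finsupp.single a 1)) ∘ₗ consMap y -
      (-1 : ℤ) ^ a.length • (pair (defect h y (Finsupp.single a 1)) ∘ₗ consMap y ∘ₗ g y) :=
    Finsupp.lhom_ext' fun b => LinearMap.ext_ring (by simp [joinHomotopy_single_cons])
  simpa using congr($this v)

/-- On `(a, y :: b)`, the homotopy contracts up to terms in which `y` has been omitted. -/
theorem sub_joinHomotopy_single_cons (a : List X) (y : Y) (b : List Y)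
    (hh : h y (Finsupp.single a 1) ∈ parityChains X (-(-1) ^ a.length))
    (hd : defect h y (Finsupp.single a 1) ∈ parityChains X ((-1) ^ a.length))
    (hg : defect h y (Finsupp.single a 1) = 0 ∨
      bd (g y (Finsupp.single b 1)) + g y (bd (Finsupp.single b 1)) = Finsupp.single b 1) :
    Finsupp.single (a, y :: b) 1 - joinBd (joinHomotopy h g (Finsupp.single (a, y :: b) 1)) -
        joinHomotopy h g (joinBd (Finsupp.single (a, y :: b) 1)) =
      (-1 : ℤ) ^ a.length • pair (h y (Finsupp.single a 1)) (Finsupp.single b 1) +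
        pair (defect h y (Finsupp.single a 1)) (g y (Finsupp.single b 1)) -
        (-1 : ℤ) ^ a.length • joinHomotopy h g (Finsupp.single (a, b) 1) := by
  have hsq : (-1 : ℤ) ^ a.length * (-1) ^ a.length = 1 := by
    rw [← mul_pow]; simp
  -- The factor `g` contracts wherever the defect of `h` does not vanish.
  have hgb : pair (defect h y (Finsupp.single a 1)) (consMap y (bd (g y (Finsupp.single b 1)))) +
      pair (defect h y (Finsupp.single a 1)) (consMap y (g y (bd (Finsupp.single b 1)))) =
      pair (defect h y (Finsupp.single a 1)) (consMap y (Finsupp.single b 1)) := by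
    rcases hg with hg | hg
    · simp [hg]
    · rw [← map_add, ← map_add, hg]
  have hpi : pair (defect h y (Finsupp.single a 1)) (consMap y (Finsupp.single b 1)) =
      Finsupp.single (a, y :: b) 1 -
        pair (h y (bd (Finsupp.single a 1))) (consMap y (Finsupp.single b 1)) -
        pair (bd (h y (Finsupp.single a 1))) (consMap y (Finsupp.single b 1)) := by
    simp [defect_apply]
  have hs : (Finsupp.single a 1 : ListChains X) ∈ parityChains X ((-1) ^ a.length) :=
    single_one_mem_supported rfl
  have e1 : joinHomotopy h g (Finsupp.single (a, y :: b) 1) =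
      pair (h y (Finsupp.single a 1)) (consMap y (Finsupp.single b 1)) - (-1 : ℤ) ^ a.length •
        pair (defect h y (Finsupp.single a 1)) (consMap y (g y (Finsupp.single b 1))) := by
    rw [joinHomotopy_single_cons, consMap_single]
  have e2 : joinBd (Finsupp.single (a, y :: b) 1) =
      pair (bd (Finsupp.single a 1)) (consMap y (Finsupp.single b 1)) +
        (-1 : ℤ) ^ a.length • (Finsupp.single (a, b) 1 -
          pair (Finsupp.single a 1) (consMap y (bd (Finsupp.single b 1)))) := by
    rw [joinBd_single, bd_single_cons, map_sub, pair_single, consMap_single]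
  rw [e1, e2, map_sub, map_smul, joinBd_pair hh, joinBd_pair hd, map_add, map_smul, map_sub,
    joinHomotopy_pair h g (bd_single_mem_parity a), joinHomotopy_pair h g hs, bd_consMap,
    bd_consMap, bd_defect]
  simp only [map_sub, smul_sub, smul_add, smul_smul, neg_smul, hsq, one_smul]
  rw [hpi] at hgb
  rw [← eq_sub_iff_add_eq'] at hgb
  rw [hgb]
  abel

end Join

section Elimination

variable {X Y : Type*} [PartialOrder X] [PartialOrder Y] (f : X →o Y) (ht : Y → ℕ)

/-- The chains of `f / y`, as lists. -/
def fiberLists (y : Y) : Set (List X) := {a | a.Pairwise (· < ·) ∧ ∀ x ∈ a, f x ≤ y}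

/-- The chains of `Link⁺(y)`, as lists. -/
def linkLists (y : Y) : Set (List Y) := {b | b.Pairwise (· < ·) ∧ ∀ u ∈ b, y < u}

/-- The chains with `k` elements of the mapping cylinder of `f`, that is, of the poset `X ⊔ Y`
in which `x < y` if and only if `f x ≤ y`, split into their parts in `X` and in `Y`. -/
def cylinderPairs (k : ℕ) : Set (List X × List Y) :=
  {p | p.1.Pairwise (· < ·) ∧ p.2.Pairwise (· < ·) ∧ (∀ x ∈ p.1, ∀ y ∈ p.2, f x ≤ y) ∧
    p.1.length + p.2.length = k}

/-- The quantity that decreases when the least element of the `Y`-part of a chain of the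
mapping cylinder is eliminated: its truncated height dominates, and the length of the `Y`-part
takes over once the height has reached `N`. -/
def weight (N : ℕ) : List X × List Y → ℕ
  | (_, []) => 0
  | (_, y :: b) => b.length + 1 + (N + 2) * (N - ht y)

theorem weight_lt_of_ht_lt (hht : StrictMono ht) {N k : ℕ} (hk : k ≤ N + 1) {y : Y}
    (hy : ht y < N) (a : List X) (b : List Y) {q : List X × List Y} (hq : q ∈ cylinderPairs f k)
    (hqy : ∀ v ∈ q.2, y < v) : weight ht N q < weight ht N (a, y :: b) := by
  obtain ⟨a', b'⟩ := q
  cases b' with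
  | nil => simp only [weight]; omega
  | cons v b' =>
    have h1 : ht y < ht v := hht (hqy v (by simp))
    have h2 : b'.length + 1 ≤ N + 1 := by
      have := hq.2.2.2
      simp only [List.length_cons] at this
      omega
    obtain ⟨e, he⟩ : ∃ e, N - ht y = (N - ht v) + 1 + e := ⟨N - ht y - (N - ht v) - 1, by omega⟩
    simp only [weight, he, mul_add]
    have := Nat.zero_le ((N + 2) * e)
    omega

variable {f ht} {h : Y → ListChains X →ₗ[ℤ] ListChains X}
  {g : Y → ListChains Y →ₗ[ℤ] ListChains Y} {N : ℕ}

theorem joinHomotopy_single_mem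
    (hmem : ∀ y, ∀ a ∈ fiberLists f y, h y (Finsupp.single a 1) ∈
      Finsupp.supported ℤ ℤ {l | l ∈ fiberLists f y ∧ l.length = a.length + 1})
    (hdef : ∀ y, ∀ a ∈ fiberLists f y, defect h y (Finsupp.single a 1) ∈
      Finsupp.supported ℤ ℤ {l | l ∈ fiberLists f y ∧ l.length = a.length})
    (gmem : ∀ y, ∀ b ∈ linkLists y, g y (Finsupp.single b 1) ∈
      Finsupp.supported ℤ ℤ {l | l ∈ linkLists y ∧ l.length = b.length + 1})
    {k : ℕ} {p : List X × List Y} (hp : p ∈ cylinderPairs f k) :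
    joinHomotopy h g (Finsupp.single p 1) ∈ Finsupp.supported ℤ ℤ
      {q | q ∈ cylinderPairs f (k + 1) ∧ ∀ u, (∀ v ∈ p.2, u < v) → ∀ v ∈ q.2, u < v} := by
  obtain ⟨a, b⟩ := p
  cases b with
  | nil => simp
  | cons y b =>
    obtain ⟨hpa, hpb, hpf, hpk⟩ := hp
    simp only [List.length_cons] at hpa hpb hpf hpk
    have ha : a ∈ fiberLists f y := ⟨hpa, fun x hx => hpf x hx y (by simp)⟩
    obtain ⟨hyb, hb⟩ := List.pairwise_cons.1 hpb
    rw [joinHomotopy_single_cons]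
    refine Submodule.sub_mem _ ?_ (Submodule.smul_mem _ _ ?_)
    · refine pair_mem (t := {y :: b}) ?_ (hmem y a ha) (single_one_mem_supported rfl)
      rintro a' ⟨ha', hlen⟩ _ rfl
      refine ⟨⟨ha'.1, hpb, fun x hx v hv => (ha'.2 x hx).trans ?_, ?_⟩, fun u hu => hu⟩
      · rcases List.mem_cons.1 hv with rfl | hv
        · exact le_rfl
        · exact (hyb v hv).le
      · simp only [List.length_cons]; omega
    · rw [consMap, Finsupp.lmapDomain_apply]
      have hgb := gmem y b ⟨hb, hyb⟩
      refine pair_mem (t := {l | ∃ b', (b' ∈ linkLists y ∧ b'.length = b.length + 1) ∧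
        l = y :: b'}) ?_ (hdef y a ha) ?_
      · rintro a' ⟨ha', hlen⟩ _ ⟨b', ⟨hb', hlen'⟩, rfl⟩
        refine ⟨⟨ha'.1, List.pairwise_cons.2 ⟨hb'.2, hb'.1⟩,
          fun x hx v hv => (ha'.2 x hx).trans ?_, ?_⟩, fun u hu v hv => ?_⟩
        · rcases List.mem_cons.1 hv with rfl | hv
          · exact le_rfl
          · exact (hb'.2 v hv).le
        · simp only [List.length_cons]; omega
        · rcases List.mem_cons.1 hv with rfl | hv
          · exact hu _ (by simp)
          · exact (hu y (by simp)).trans (hb'.2 v hv)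
      · refine map_mem_of_mem_supported (Finsupp.lmapDomain ℤ ℤ (List.cons y))
          (fun b' hb' => ?_) hgb
        rw [Finsupp.lmapDomain_apply, Finsupp.mapDomain_single]
        exact single_one_mem_supported ⟨b', hb', rfl⟩

/-- The defect of `joinHomotopy` from being a contraction strictly decreases the weight. If
`ht y < N`, the terms left have a `Y`-part beginning above `y`. If `N ≤ ht y`, then `defect h y`
vanishes on `a`, and the `Y`-parts left are obtained from `y :: b` by omitting `y`. -/
theorem sub_joinHomotopy_single_mem (hht : StrictMono ht)
    (hmem : ∀ y, ∀ a ∈ fiberLists f y, h y (Finsupp.single a 1) ∈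
      Finsupp.supported ℤ ℤ {l | l ∈ fiberLists f y ∧ l.length = a.length + 1})
    (hdef : ∀ y, ∀ a ∈ fiberLists f y, defect h y (Finsupp.single a 1) ∈
      Finsupp.supported ℤ ℤ {l | l ∈ fiberLists f y ∧ l.length = a.length})
    (hzero : ∀ y, ∀ a ∈ fiberLists f y, a.length ≤ ht y → defect h y (Finsupp.single a 1) = 0)
    (gmem : ∀ y, ∀ b ∈ linkLists y, g y (Finsupp.single b 1) ∈
      Finsupp.supported ℤ ℤ {l | l ∈ linkLists y ∧ l.length = b.length + 1})
    (gcon : ∀ y, ∀ b ∈ linkLists y, b.length + ht y < N →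
      bd (g y (Finsupp.single b 1)) + g y (bd (Finsupp.single b 1)) = Finsupp.single b 1)
    {k : ℕ} (hk : k ≤ N + 1) (a : List X) (y : Y) (b : List Y)
    (hp : (a, y :: b) ∈ cylinderPairs f k) :
    Finsupp.single (a, y :: b) 1 - joinBd (joinHomotopy h g (Finsupp.single (a, y :: b) 1)) -
        joinHomotopy h g (joinBd (Finsupp.single (a, y :: b) 1)) ∈
      Finsupp.supported ℤ ℤ
        {q | q ∈ cylinderPairs f k ∧ weight ht N q < weight ht N (a, y :: b)} := by
  obtain ⟨hpa, hpb, hpf, hpk⟩ := hp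
  simp only [List.length_cons] at hpa hpb hpf hpk
  have ha : a ∈ fiberLists f y := ⟨hpa, fun x hx => hpf x hx y (by simp)⟩
  obtain ⟨hyb, hb⟩ := List.pairwise_cons.1 hpb
  have hha := hmem y a ha
  have hab : (a, b) ∈ cylinderPairs f (k - 1) :=
    ⟨hpa, hb, fun x hx v hv => hpf x hx v (by simp [hv]), by simp only; omega⟩
  have hk1 : k - 1 + 1 = k := by omega
  -- The pairs `(a', b)` with `a'` one longer than `a` are chains of the mapping cylinder.
  have hval : ∀ y', (∀ v ∈ b, y' ≤ v) → ∀ a' ∈ fiberLists f y', a'.length = a.length + 1 →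
      (a', b) ∈ cylinderPairs f k := fun y' hy' a' ha' hlen =>
    ⟨ha'.1, hb, fun x hx v hv => (ha'.2 x hx).trans (hy' v hv), by simp only; omega⟩
  rw [sub_joinHomotopy_single_cons h g a y b]
  · by_cases hy : ht y < N
    · refine Submodule.sub_mem _ (Submodule.add_mem _ (Submodule.smul_mem _ _ ?_) ?_)
        (Submodule.smul_mem _ _ ?_)
      · refine pair_mem (t := {b}) ?_ hha (single_one_mem_supported rfl)
        rintro a' ⟨ha', hlen⟩ _ rfl
        have := hval y (fun v hv => (hyb v hv).le) a' ha' hlen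
        exact ⟨this, weight_lt_of_ht_lt f ht hht hk hy a _ this hyb⟩
      · refine pair_mem ?_ (hdef y a ha) (gmem y b ⟨hb, hyb⟩)
        rintro a' ⟨ha', hlen⟩ b' ⟨hb', hlen'⟩
        have : (a', b') ∈ cylinderPairs f k :=
          ⟨ha'.1, hb'.1, fun x hx v hv => (ha'.2 x hx).trans (hb'.2 v hv).le, by simp only; omega⟩
        exact ⟨this, weight_lt_of_ht_lt f ht hht hk hy a _ this hb'.2⟩
      · refine mem_supported_of_imp ?_ (joinHomotopy_single_mem hmem hdef gmem hab)
        rintro q ⟨hq, hqv⟩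
        rw [hk1] at hq
        exact ⟨hq, weight_lt_of_ht_lt f ht hht hk hy a _ hq (hqv y hyb)⟩
    -- In large height only the contractions of the complexes of `f / y` intervene.
    · have hw : ∀ a', (a', b) ∈ cylinderPairs f k →
          weight ht N (a', b) < weight ht N (a, y :: b) := by
        intro a' _
        cases b with
        | nil => simp only [weight]; omega
        | cons v b =>
          have : ht y < ht v := hht (hyb v (by simp))
          have e1 : N - ht v = 0 := by omega
          simp only [weight, e1, List.length_cons, mul_zero]
          omega
      rw [hzero y a ha (by omega), map_zero, LinearMap.zero_apply, add_zero]
      refine Submodule.sub_mem _ (Submodule.smul_mem _ _ ?_) (Submodule.smul_mem _ _ ?_)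
      · refine pair_mem (t := {b}) ?_ hha (single_one_mem_supported rfl)
        rintro a' ⟨ha', hlen⟩ _ rfl
        have := hval y (fun v hv => (hyb v hv).le) a' ha' hlen
        exact ⟨this, hw _ this⟩
      · cases b with
        | nil => simp
        | cons v b =>
          have hv : ht y < ht v := hht (hyb v (by simp))
          have hav : a ∈ fiberLists f v := ⟨hpa, fun x hx => hpf x hx v (by simp)⟩
          rw [joinHomotopy_single_cons, hzero v a hav (by omega), map_zero,
            LinearMap.zero_apply, smul_zero, sub_zero]
          refine pair_mem (t := {v :: b}) ?_ (hmem v a hav) (single_one_mem_supported rfl)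
          rintro a' ⟨ha', hlen⟩ _ rfl
          have := hval v (fun w hw => ?_) a' ha' hlen
          · exact ⟨this, hw _ this⟩
          · rcases List.mem_cons.1 hw with rfl | hw
            · exact le_rfl
            · exact ((List.pairwise_cons.1 hb).1 w hw).le
  · refine mem_supported_of_imp (fun l hl => ?_) hha
    simp [hl.2, pow_succ]
  · refine mem_supported_of_imp (fun l hl => ?_) (hdef y a ha)
    simp [hl.2]
  · by_cases hay : a.length ≤ ht y
    · exact Or.inl (hzero y a ha hay)
    · exact Or.inr (gcon y b ⟨hb, hyb⟩ (by omega))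

/-- The homology of the mapping cylinder relative to `X` vanishes in low degrees: subtracting
boundaries, a relative cycle is pushed into ever smaller weight, and thus into `X`. -/
theorem exists_sub_joinBd_mem (hht : StrictMono ht)
    (hmem : ∀ y, ∀ a ∈ fiberLists f y, h y (Finsupp.single a 1) ∈
      Finsupp.supported ℤ ℤ {l | l ∈ fiberLists f y ∧ l.length = a.length + 1})
    (hcon : ∀ y, ∀ a ∈ fiberLists f y, a.length < ht y + 1 →
      bd (h y (Finsupp.single a 1)) + h y (bd (Finsupp.single a 1)) = Finsupp.single a 1)
    (gmem : ∀ y, ∀ b ∈ linkLists y, g y (Finsupp.single b 1) ∈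
      Finsupp.supported ℤ ℤ {l | l ∈ linkLists y ∧ l.length = b.length + 1})
    (gcon : ∀ y, ∀ b ∈ linkLists y, b.length + ht y < N →
      bd (g y (Finsupp.single b 1)) + g y (bd (Finsupp.single b 1)) = Finsupp.single b 1)
    {k : ℕ} (hk : k ≤ N + 1) {c : PairChains X Y}
    (hc : c ∈ Finsupp.supported ℤ ℤ (cylinderPairs f k))
    (hcb : joinBd c ∈ Finsupp.supported ℤ ℤ {q : List X × List Y | q.2 = []}) :
    ∃ w ∈ Finsupp.supported ℤ ℤ (cylinderPairs f (k + 1)),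
      c - joinBd w ∈ Finsupp.supported ℤ ℤ {q | q ∈ cylinderPairs f k ∧ q.2 = []} := by
  have hsub : ∀ y, ∀ a ∈ fiberLists f y, ∀ l : List X, l.Sublist a → l ∈ fiberLists f y :=
    fun y a ha l hl => ⟨ha.1.sublist hl, fun x hx => ha.2 x (hl.subset hx)⟩
  have hdef : ∀ y, ∀ a ∈ fiberLists f y, defect h y (Finsupp.single a 1) ∈
      Finsupp.supported ℤ ℤ {l | l ∈ fiberLists f y ∧ l.length = a.length} := by
    intro y a ha
    refine Submodule.sub_mem _ (Submodule.sub_mem _ (single_one_mem_supported ⟨ha, rfl⟩) ?_) ?_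
    · refine map_mem_of_mem_supported (h y) (fun l hl => ?_) (bd_single_mem a)
      exact mem_supported_of_imp (fun l' hl' => by exact ⟨hl'.1, hl'.2.trans hl.2⟩)
        (hmem y l (hsub y a ha l hl.1))
    · refine map_mem_of_mem_supported bd (fun l hl => ?_) (hmem y a ha)
      refine mem_supported_of_imp (fun l' hl' => ?_) (bd_single_mem l)
      refine ⟨hsub y l hl.1 l' hl'.1, ?_⟩
      have h1 := hl'.2
      have h2 := hl.2
      omega
  have hzero : ∀ y, ∀ a ∈ fiberLists f y, a.length ≤ ht y →
      defect h y (Finsupp.single a 1) = 0 := fun y a ha hlen => by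
    rw [defect_apply, sub_sub, sub_eq_zero, add_comm]
    exact (hcon y a ha (by omega)).symm
  obtain ⟨r, hr⟩ : ∃ r, c ∈ Finsupp.supported ℤ ℤ {q | q ∈ cylinderPairs f k ∧
      weight ht N q ≤ r} :=
    ⟨c.support.sup (weight ht N), fun q hq => ⟨hc hq, Finset.le_sup (f := weight ht N) hq⟩⟩
  clear hc
  induction r generalizing c with
  | zero =>
    refine ⟨0, zero_mem _, ?_⟩
    rw [map_zero, sub_zero]
    refine mem_supported_of_imp ?_ hr
    rintro ⟨a, b⟩ ⟨hq, hw⟩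
    refine ⟨hq, ?_⟩
    cases b with
    | nil => rfl
    | cons y b => simp only [weight] at hw; omega
  | succ r ih =>
    have hH : joinHomotopy h g (joinBd c) = 0 :=
      eqOn_of_mem_supported (ψ := 0)
        (by rintro ⟨a, b⟩ (rfl : b = []); simp) hcb
    have hHc : joinHomotopy h g c ∈ Finsupp.supported ℤ ℤ (cylinderPairs f (k + 1)) :=
      map_mem_of_mem_supported _ (fun q hq => mem_supported_of_imp (fun _ h' => h'.1)
        (joinHomotopy_single_mem hmem hdef gmem hq.1)) hr
    have hN : c - joinBd (joinHomotopy h g c) ∈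
        Finsupp.supported ℤ ℤ {q | q ∈ cylinderPairs f k ∧ weight ht N q ≤ r} := by
      have := map_mem_of_mem_supported
        (LinearMap.id - joinBd ∘ₗ joinHomotopy h g - joinHomotopy h g ∘ₗ joinBd)
        (N := Finsupp.supported ℤ ℤ {q | q ∈ cylinderPairs f k ∧ weight ht N q ≤ r})
        (fun q hq => ?_) hr
      · simpa [hH] using this
      · obtain ⟨a, b⟩ := q
        cases b with
        | nil =>
          have h0 : joinHomotopy h g (joinBd (Finsupp.single (a, []) 1)) = 0 := by
            rw [joinBd_single, bd_single_nil, map_zero, smul_zero, add_zero]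
            refine eqOn_of_mem_supported (φ := joinHomotopy h g ∘ₗ pair.flip (Finsupp.single [] 1))
              (ψ := 0) (fun l _ => by simp) (bd_single_mem a)
          simp only [LinearMap.sub_apply, LinearMap.id_apply, LinearMap.comp_apply, h0,
            joinHomotopy_single_nil, map_zero, sub_zero]
          exact single_one_mem_supported ⟨hq.1, by simp [weight]⟩
        | cons y b =>
          refine mem_supported_of_imp (fun q' hq' => ?_)
            (sub_joinHomotopy_single_mem hht hmem hdef hzero gmem gcon hk a y b hq.1)
          refine ⟨hq'.1, ?_⟩
          have h1 := hq'.2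
          have h2 := hq.2
          omega
    obtain ⟨w, hw, hcw⟩ := ih (by rwa [map_sub, joinBd_joinBd, sub_zero]) hN
    exact ⟨joinHomotopy h g c + w, add_mem hHc hw, by rwa [map_add, ← sub_sub]⟩

end Elimination

/-! ### The retraction and the prism of the mapping cylinder -/

section Normalize

variable {X Y : Type*}

/-- Applying `f` to all entries of a list. -/
noncomputable def listMap (f : X → Y) : ListChains X →ₗ[ℤ] ListChains Y :=
  Finsupp.lmapDomain ℤ ℤ (List.map f)

theorem listMap_single (f : X → Y) (l : List X) :
    listMap f (Finsupp.single l 1) = Finsupp.single (l.map f) 1 := by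
  simp [listMap]

theorem bd_listMap (f : X → Y) (c : ListChains X) : bd (listMap f c) = listMap f (bd c) := by
  have : bd ∘ₗ listMap f = listMap f ∘ₗ bd := by
    refine Finsupp.lhom_ext' fun l => LinearMap.ext_ring ?_
    simp only [LinearMap.comp_apply, Finsupp.lsingle_apply, listMap_single]
    induction l with
    | nil => simp
    | cons x l ih =>
      have hc : consMap (f x) ∘ₗ listMap f = listMap f ∘ₗ consMap x :=
        Finsupp.lhom_ext' fun l => LinearMap.ext_ring (by simp [listMap_single])
      rw [List.map_cons, bd_single_cons, bd_single_cons, ih, map_sub, listMap_single]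
      exact congrArg _ congr($hc _)
  exact congr($this c)

variable [PartialOrder Y]

open Classical in
/-- The projection of list chains that keeps the strictly increasing lists and kills all others. -/
noncomputable def normalize : ListChains Y →ₗ[ℤ] ListChains Y :=
  Finsupp.linearCombination ℤ fun l => if l.Pairwise (· < ·) then Finsupp.single l 1 else 0

theorem normalize_single_of_pairwise {l : List Y} (hl : l.Pairwise (· < ·)) :
    normalize (Finsupp.single l 1) = Finsupp.single l 1 := by
  simp [normalize, hl]

theorem normalize_single_of_not_pairwise {l : List Y} (hl : ¬ l.Pairwise (· < ·)) :
    normalize (Finsupp.single l 1) = 0 := by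
  simp [normalize, hl]

theorem normalize_eq_self {c : ListChains Y}
    (hc : c ∈ Finsupp.supported ℤ ℤ {l : List Y | l.Pairwise (· < ·)}) : normalize c = c :=
  eqOn_of_mem_supported (ψ := LinearMap.id) (fun _ hl => normalize_single_of_pairwise hl) hc

theorem normalize_single_mem (l : List Y) : normalize (Finsupp.single l 1) ∈
    Finsupp.supported ℤ ℤ {l' : List Y | l' = l ∧ l'.Pairwise (· < ·)} := by
  by_cases hl : l.Pairwise (· < ·)
  · rw [normalize_single_of_pairwise hl]
    exact single_one_mem_supported ⟨rfl, hl⟩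
  · rw [normalize_single_of_not_pairwise hl]
    exact zero_mem _

theorem normalize_consMap {x : Y} {c : ListChains Y}
    (hc : c ∈ Finsupp.supported ℤ ℤ {l : List Y | ∀ y ∈ l, x < y}) :
    normalize (consMap x c) = consMap x (normalize c) := by
  refine eqOn_of_mem_supported (φ := normalize ∘ₗ consMap x) (ψ := consMap x ∘ₗ normalize)
    (fun l hl => ?_) hc
  simp only [LinearMap.comp_apply, consMap_single]
  by_cases hs : l.Pairwise (· < ·)
  · rw [normalize_single_of_pairwise hs,
      normalize_single_of_pairwise (List.pairwise_cons.2 ⟨hl, hs⟩), consMap_single]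
  · rw [normalize_single_of_not_pairwise hs,
      normalize_single_of_not_pairwise fun h => hs (List.pairwise_cons.1 h).2, map_zero]

/-- On weakly increasing lists, killing the lists with repetitions commutes with the boundary:
the two faces omitting one of two equal neighbours cancel. -/
theorem bd_normalize_single {l : List Y} (hl : l.Pairwise (· ≤ ·)) :
    bd (normalize (Finsupp.single l 1)) = normalize (bd (Finsupp.single l 1)) := by
  induction l with
  | nil => rw [normalize_single_of_pairwise List.Pairwise.nil, bd_single_nil, map_zero]
  | cons x l ih =>
    by_cases hs : (x :: l).Pairwise (· < ·)
    · rw [normalize_single_of_pairwise hs, normalize_eq_self]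
      exact mem_supported_of_imp (fun l' hl' => hs.sublist hl'.1) (bd_single_mem _)
    rw [normalize_single_of_not_pairwise hs, map_zero]
    cases l with
    | nil => exact absurd (List.pairwise_singleton _ _) hs
    | cons y l =>
      obtain ⟨hx, hl'⟩ := List.pairwise_cons.1 hl
      rcases (hx y (by simp)).eq_or_lt with rfl | hxy
      · have hxx : bd (Finsupp.single (x :: x :: l) 1) =
            consMap x (consMap x (bd (Finsupp.single l 1))) := by
          rw [bd_single_cons, bd_single_cons, map_sub, consMap_single, sub_sub_cancel]
        rw [hxx]
        symm
        refine eqOn_of_mem_supported (φ := normalize ∘ₗ consMap x ∘ₗ consMap x) (ψ := 0)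
          (fun l'' _ => ?_) (bd_single_mem l)
        simp only [LinearMap.comp_apply, consMap_single, LinearMap.zero_apply]
        exact normalize_single_of_not_pairwise (by simp)
      · have hlt : ∀ z ∈ y :: l, x < z := fun z hz => by
          rcases List.mem_cons.1 hz with rfl | hz
          · exact hxy
          · exact hxy.trans_le ((List.pairwise_cons.1 hl').1 z hz)
        have hns : ¬ (y :: l).Pairwise (· < ·) := fun h => hs (List.pairwise_cons.2 ⟨hlt, h⟩)
        rw [bd_single_cons, map_sub, normalize_consMap, ← ih hl',
          normalize_single_of_not_pairwise hns]
        · simp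
        · refine mem_supported_of_imp (fun l'' h'' => ?_) (bd_single_mem _)
          exact fun z hz => hlt z (h''.1.subset hz)

/-- The map induced by `f` on chains, killing the lists whose image is degenerate. -/
noncomputable def listPush (f : X → Y) : ListChains X →ₗ[ℤ] ListChains Y :=
  normalize ∘ₗ listMap f

theorem listPush_single (f : X → Y) (l : List X) :
    listPush f (Finsupp.single l 1) = normalize (Finsupp.single (l.map f) 1) := by
  simp [listPush, listMap_single]

theorem pairwise_le_map [PartialOrder X] (f : X →o Y) {l : List X} (hl : l.Pairwise (· < ·)) :
    (l.map f).Pairwise (· ≤ ·) :=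
  List.pairwise_map.2 (hl.imp fun h => f.monotone h.le)

theorem bd_listPush_single [PartialOrder X] (f : X →o Y) {l : List X} (hl : l.Pairwise (· < ·)) :
    bd (listPush f (Finsupp.single l 1)) = listPush f (bd (Finsupp.single l 1)) := by
  rw [listPush_single, bd_normalize_single (pairwise_le_map f hl), listPush, LinearMap.comp_apply,
    ← bd_listMap, listMap_single]

end Normalize

section Cylinder

variable {X Y : Type*}

/-- Prepending `x` to the first list of a pair. -/
noncomputable def consPair (x : X) : PairChains X Y →ₗ[ℤ] PairChains X Y :=
  Finsupp.lmapDomain ℤ ℤ fun p => (x :: p.1, p.2)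

theorem consPair_single (x : X) (p : List X × List Y) :
    consPair x (Finsupp.single p 1) = Finsupp.single (x :: p.1, p.2) 1 := by
  simp [consPair]

theorem consPair_pair (x : X) (u : ListChains X) (v : ListChains Y) :
    consPair x (pair u v) = pair (consMap x u) v := by
  have : pair.compr₂ (consPair x) = (pair : _ →ₗ[ℤ] _ →ₗ[ℤ] PairChains X Y) ∘ₗ consMap x :=
    Finsupp.lhom_ext' fun a => LinearMap.ext_ring <|
      Finsupp.lhom_ext' fun b => LinearMap.ext_ring (by simp [consPair_single])
  exact congr($this u v)

theorem joinBd_consPair (x : X) (c : PairChains X Y) :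
    joinBd (consPair x c) = c - consPair x (joinBd c) := by
  have : joinBd ∘ₗ consPair x = LinearMap.id - consPair (Y := Y) x ∘ₗ joinBd := by
    refine Finsupp.lhom_ext' fun p => LinearMap.ext_ring ?_
    obtain ⟨a, b⟩ := p
    simp only [LinearMap.comp_apply, Finsupp.lsingle_apply, LinearMap.sub_apply,
      LinearMap.id_apply, consPair_single, joinBd_single, bd_single_cons, map_add, map_sub,
      map_smul, consPair_pair, consMap_single, pair_single, List.length_cons, pow_succ]
    simp only [mul_neg, mul_one, neg_smul]
    abel
  exact congr($this c)

theorem joinBd_pair_nil_left (v : ListChains Y) :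
    joinBd (pair (Finsupp.single ([] : List X) 1) v) =
      pair (Finsupp.single ([] : List X) 1) (bd v) := by
  rw [joinBd_pair (ε := 1) (single_one_mem_supported (by simp)), bd_single_nil]
  simp

theorem joinBd_pair_nil_right (u : ListChains X) :
    joinBd (pair u (Finsupp.single ([] : List Y) 1)) =
      pair (bd u) (Finsupp.single ([] : List Y) 1) := by
  have : joinBd ∘ₗ pair.flip (Finsupp.single ([] : List Y) 1) =
      pair.flip (Finsupp.single ([] : List Y) 1) ∘ₗ bd (T := X) :=
    Finsupp.lhom_ext' fun a => LinearMap.ext_ring (by simp [joinBd_single])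
  exact congr($this u)

theorem lmapDomain_fst_pair_nil_right (u : ListChains X) :
    Finsupp.lmapDomain ℤ ℤ Prod.fst (pair u (Finsupp.single ([] : List Y) 1)) = u := by
  have : Finsupp.lmapDomain ℤ ℤ Prod.fst ∘ₗ pair.flip (Finsupp.single ([] : List Y) 1) =
      (LinearMap.id : ListChains X →ₗ[ℤ] ListChains X) :=
    Finsupp.lhom_ext' fun a => LinearMap.ext_ring (by simp)
  exact congr($this u)

theorem exists_pair_nil_eq {s : Set (List X × List Y)} {c : PairChains X Y}
    (hc : c ∈ Finsupp.supported ℤ ℤ {q | q ∈ s ∧ q.2 = []}) :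
    ∃ u ∈ Finsupp.supported ℤ ℤ {a | (a, []) ∈ s}, pair u (Finsupp.single [] 1) = c := by
  have := map_mem_of_mem_supported LinearMap.id
    (N := (Finsupp.supported ℤ ℤ {a | (a, []) ∈ s}).map (pair.flip (Finsupp.single [] 1)))
    (by
      rintro ⟨a, b⟩ ⟨hs, rfl : b = []⟩
      exact ⟨Finsupp.single a 1, single_one_mem_supported hs, by simp⟩) hc
  exact this

variable [PartialOrder X] [PartialOrder Y] (f : X →o Y)

/-- The retraction of the mapping cylinder of `f` onto `Y`, on chains. -/
noncomputable def retract : PairChains X Y →ₗ[ℤ] ListChains Y :=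
  normalize ∘ₗ Finsupp.lmapDomain ℤ ℤ fun p => p.1.map f ++ p.2

theorem retract_single (a : List X) (b : List Y) :
    retract f (Finsupp.single (a, b) 1) = normalize (Finsupp.single (a.map f ++ b) 1) := by
  simp [retract]

theorem retract_pair_nil_left (v : ListChains Y) :
    retract f (pair (Finsupp.single [] 1) v) = normalize v := by
  have : retract f ∘ₗ pair (Finsupp.single [] 1) = normalize :=
    Finsupp.lhom_ext' fun b => LinearMap.ext_ring (by simp [retract_single])
  exact congr($this v)

theorem retract_pair_nil_right (u : ListChains X) :
    retract f (pair u (Finsupp.single [] 1)) = listPush f u := by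
  have : retract f ∘ₗ pair.flip (Finsupp.single [] 1) = listPush f :=
    Finsupp.lhom_ext' fun a => LinearMap.ext_ring (by simp [retract_single, listPush_single])
  exact congr($this u)

theorem lmapDomain_append_joinBd (a : List X) (b : List Y) :
    Finsupp.lmapDomain ℤ ℤ (fun p : List X × List Y => p.1.map f ++ p.2)
      (joinBd (Finsupp.single (a, b) 1)) = bd (Finsupp.single (a.map f ++ b) 1) := by
  induction a with
  | nil =>
    rw [← pair_single, joinBd_pair_nil_left, List.map_nil, List.nil_append]
    have : Finsupp.lmapDomain ℤ ℤ (fun p : List X × List Y => p.1.map f ++ p.2) ∘ₗ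
        pair (Finsupp.single [] 1) = LinearMap.id :=
      Finsupp.lhom_ext' fun b => LinearMap.ext_ring (by simp)
    exact congr($this _)
  | cons x a ih =>
    have hc : Finsupp.lmapDomain ℤ ℤ (fun p : List X × List Y => p.1.map f ++ p.2) ∘ₗ consPair x =
        consMap (f x) ∘ₗ Finsupp.lmapDomain ℤ ℤ (fun p : List X × List Y => p.1.map f ++ p.2) :=
      Finsupp.lhom_ext' fun b => LinearMap.ext_ring (by simp [consPair_single])
    have h1 := consPair_single x (a, b)
    rw [← h1, joinBd_consPair, map_sub, ← LinearMap.comp_apply, hc, LinearMap.comp_apply, ih,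
      List.map_cons, List.cons_append, bd_single_cons]
    simp

theorem retract_joinBd {k : ℕ} {c : PairChains X Y}
    (hc : c ∈ Finsupp.supported ℤ ℤ (cylinderPairs f k)) :
    retract f (joinBd c) = bd (retract f c) := by
  refine eqOn_of_mem_supported (φ := retract f ∘ₗ joinBd) (ψ := bd ∘ₗ retract f) ?_ hc
  rintro ⟨a, b⟩ ⟨ha, hb, hab, -⟩
  simp only [LinearMap.comp_apply, retract_single]
  rw [bd_normalize_single, ← lmapDomain_append_joinBd, retract, LinearMap.comp_apply]
  refine List.pairwise_append.2 ⟨pairwise_le_map f ha, hb.imp le_of_lt, fun x' hx' y hy => ?_⟩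
  obtain ⟨x, hx, rfl⟩ := List.mem_map.1 hx'
  exact hab x hx y hy

theorem retract_mem {k : ℕ} {c : PairChains X Y}
    (hc : c ∈ Finsupp.supported ℤ ℤ (cylinderPairs f k)) :
    retract f c ∈ Finsupp.supported ℤ ℤ {l : List Y | l.Pairwise (· < ·) ∧ l.length = k} := by
  refine map_mem_of_mem_supported _ ?_ hc
  rintro ⟨a, b⟩ ⟨-, -, -, hk⟩
  rw [retract_single]
  refine mem_supported_of_imp (fun l hl => ?_) (normalize_single_mem _)
  refine ⟨hl.2, ?_⟩
  rw [hl.1, List.length_append, List.length_map]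
  exact hk

/-- The prism on a list `x₀ < ⋯ < xₖ` in `X`: the alternating sum of the chains
`x₀ < ⋯ < xᵢ < f xᵢ ≤ ⋯ ≤ f xₖ` of the mapping cylinder. -/
noncomputable def listPrism : List X → PairChains X Y
  | [] => 0
  | x :: l => pair (Finsupp.single [x] 1) (listPush f (Finsupp.single (x :: l) 1)) -
      consPair x (listPrism l)

/-- The linear extension of `listPrism`. -/
noncomputable def prism : ListChains X →ₗ[ℤ] PairChains X Y :=
  Finsupp.linearCombination ℤ (listPrism f)

theorem prism_single_nil : prism f (Finsupp.single [] 1) = 0 := by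
  simp [prism, listPrism]

theorem prism_single_cons (x : X) (l : List X) : prism f (Finsupp.single (x :: l) 1) =
    pair (Finsupp.single [x] 1) (listPush f (Finsupp.single (x :: l) 1)) -
      consPair x (prism f (Finsupp.single l 1)) := by
  simp [prism, listPrism]

theorem prism_consMap (x : X) (c : ListChains X) : prism f (consMap x c) =
    pair (Finsupp.single [x] 1) (listPush f (consMap x c)) - consPair x (prism f c) := by
  have : prism f ∘ₗ consMap x =
      pair (Finsupp.single [x] 1) ∘ₗ listPush f ∘ₗ consMap x - consPair x ∘ₗ prism f :=
    Finsupp.lhom_ext' fun l => LinearMap.ext_ring (by simp [prism_single_cons])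
  exact congr($this c)

/-- The prism is a homotopy between the inclusion of `X` in the mapping cylinder and `f`. -/
theorem joinBd_prism_single {l : List X} (hl : l.Pairwise (· < ·)) :
    joinBd (prism f (Finsupp.single l 1)) + prism f (bd (Finsupp.single l 1)) =
      pair (Finsupp.single [] 1) (listPush f (Finsupp.single l 1)) - Finsupp.single (l, []) 1 := by
  induction l with
  | nil =>
    rw [prism_single_nil, bd_single_nil, map_zero, map_zero, listPush_single, List.map_nil,
      normalize_single_of_pairwise List.Pairwise.nil, pair_single]
    simp
  | cons x l ih =>
    have ih := ih (List.pairwise_cons.1 hl).2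
    have hx : joinBd (pair (Finsupp.single [x] 1) (listPush f (Finsupp.single (x :: l) 1))) =
        pair (Finsupp.single [] 1) (listPush f (Finsupp.single (x :: l) 1)) -
          pair (Finsupp.single [x] 1) (listPush f (Finsupp.single l 1)) +
          pair (Finsupp.single [x] 1) (listPush f (consMap x (bd (Finsupp.single l 1)))) := by
      rw [joinBd_pair (ε := -1) (single_one_mem_supported (by simp)), bd_listPush_single f hl,
        bd_single_cons, bd_single_cons, bd_single_nil]
      simp only [map_zero, sub_zero, map_sub, smul_sub, neg_smul, one_smul]
      abel
    have ihx := congrArg (consPair x) ih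
    rw [map_add, map_sub, consPair_pair, consMap_single, consPair_single] at ihx
    rw [prism_single_cons, map_sub, hx, joinBd_consPair, bd_single_cons, map_sub, prism_consMap,
      ← sub_eq_zero]
    rw [← sub_eq_zero] at ihx
    rw [← ihx]
    abel

theorem prism_single_mem {l : List X} (hl : l.Pairwise (· < ·)) :
    prism f (Finsupp.single l 1) ∈ Finsupp.supported ℤ ℤ
      {q | q ∈ cylinderPairs f (l.length + 1) ∧ q.1 ⊆ l ∧ q.2 ⊆ l.map f} := by
  induction l with
  | nil => rw [prism_single_nil]; exact zero_mem _
  | cons x l ih =>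
    obtain ⟨hxl, hl'⟩ := List.pairwise_cons.1 hl
    rw [prism_single_cons, listPush_single]
    refine Submodule.sub_mem _ ?_ ?_
    · refine pair_mem (s := {[x]}) ?_ (single_one_mem_supported rfl) (normalize_single_mem _)
      rintro _ rfl b ⟨rfl, hb⟩
      refine ⟨⟨List.pairwise_singleton _ _, hb, fun x' hx' y hy => ?_, ?_⟩, ?_, fun y hy => hy⟩
      · obtain rfl := List.mem_singleton.1 hx'
        obtain ⟨z, hz, rfl⟩ := List.mem_map.1 hy
        rcases List.mem_cons.1 hz with rfl | hz
        · exact le_rfl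
        · exact f.monotone (hxl z hz).le
      · simp only [List.length_cons, List.length_nil, List.length_map]; omega
      · simp
    · refine map_mem_of_mem_supported (consPair x) ?_ (ih hl')
      rintro ⟨a, b⟩ ⟨⟨ha, hb, hab, hlen⟩, hal, hbl⟩
      simp only at ha hb hab hlen hal hbl
      rw [consPair_single]
      refine single_one_mem_supported ⟨⟨List.pairwise_cons.2 ⟨fun z hz => hxl z (hal hz), ha⟩, hb,
        fun z hz y hy => ?_, ?_⟩, ?_, fun y hy => List.mem_cons_of_mem _ (hbl hy)⟩
      · rcases List.mem_cons.1 hz with rfl | hz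
        · obtain ⟨z', hz', rfl⟩ := List.mem_map.1 (hbl hy)
          exact f.monotone (hxl z' hz').le
        · exact hab z hz y hy
      · simp only [List.length_cons]; omega
      · exact List.cons_subset_cons x hal

end Cylinder

/-! ### Comparison with the complex of a poset -/

section Comparison

variable {S X Y : Type u} [PartialOrder S] [PartialOrder X] [PartialOrder Y] (e : S ↪o X)

/-- The chains of the poset `S`, viewed via an order embedding `S ↪o X` as chains of lists
in `X`. -/
noncomputable def toListChains (n : ℕ) : Chains S n →ₗ[ℤ] ListChains X :=
  Finsupp.lmapDomain ℤ ℤ fun s => List.ofFn (e ∘ s.1)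

theorem toListChains_single {n : ℕ} (s : Simplex S n) :
    toListChains e n (Finsupp.single s 1) = Finsupp.single (List.ofFn (e ∘ s.1)) 1 := by
  simp [toListChains]

theorem toListChains_injective (n : ℕ) : Function.Injective (toListChains e n) :=
  Finsupp.mapDomain_injective fun _ _ h =>
    Subtype.ext (e.injective.comp_left (List.ofFn_injective h))

theorem pairwise_ofFn_comp {n : ℕ} (s : Simplex S n) :
    (List.ofFn (e ∘ s.1)).Pairwise (· < ·) :=
  List.pairwise_ofFn.2 fun _ _ h => e.strictMono (s.2 h)

theorem toListChains_mem (n : ℕ) (c : Chains S n) :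
    toListChains e n c ∈ Finsupp.supported ℤ ℤ
      {l : List X | (l.Pairwise (· < ·) ∧ ∀ x ∈ l, x ∈ Set.range e) ∧ l.length = n + 1} := by
  refine map_mem_of_mem_supported (s := Set.univ) _ (fun s _ => ?_) (by simp)
  rw [toListChains_single]
  refine single_one_mem_supported ⟨⟨pairwise_ofFn_comp e s, fun x hx => ?_⟩, by simp⟩
  obtain ⟨i, rfl⟩ := (List.mem_ofFn' _ _).1 hx
  exact ⟨s.1 i, rfl⟩

theorem exists_toListChains_eq {n : ℕ} {c : ListChains X} (hc : c ∈ Finsupp.supported ℤ ℤ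
      {l : List X | (l.Pairwise (· < ·) ∧ ∀ x ∈ l, x ∈ Set.range e) ∧ l.length = n + 1}) :
    ∃ c' : Chains S n, toListChains e n c' = c := by
  refine map_mem_of_mem_supported LinearMap.id (N := LinearMap.range (toListChains e n)) ?_ hc
  rintro l ⟨⟨hl, hr⟩, hlen⟩
  choose t ht using fun i : Fin (n + 1) => hr (l.get (i.cast hlen.symm)) (List.get_mem _ _)
  have hmono : StrictMono t := fun i j hij => by
    rw [← e.lt_iff_lt, ht, ht]
    exact List.pairwise_iff_get.1 hl _ _ hij
  refine ⟨Finsupp.single ⟨t, hmono⟩ 1, ?_⟩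
  rw [toListChains_single, LinearMap.id_apply]
  congr 1
  refine List.ext_get (by simp [hlen]) fun i h1 h2 => ?_
  rw [List.get_eq_getElem, List.getElem_ofFn]
  exact ht _

theorem bd_toListChains (n : ℕ) (c : Chains S (n + 1)) :
    bd (toListChains e (n + 1) c) = toListChains e n (boundary S n c) := by
  have : bd ∘ₗ toListChains e (n + 1) = toListChains e n ∘ₗ boundary S n := by
    refine Finsupp.lhom_ext' fun s => LinearMap.ext_ring ?_
    simp only [LinearMap.comp_apply, Finsupp.lsingle_apply, toListChains_single, bd_single_ofFn,
      boundary_single, map_sum, map_smul]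
    rfl
  exact congr($this c)

theorem toListChains_chainsMap (f : X →o Y) (n : ℕ) (c : Chains X n) :
    toListChains (RelEmbedding.refl (· ≤ ·)) n (chainsMap f n c) =
      listPush f (toListChains (RelEmbedding.refl (· ≤ ·)) n c) := by
  have : toListChains (RelEmbedding.refl (· ≤ ·)) n ∘ₗ chainsMap f n =
      listPush f ∘ₗ toListChains (RelEmbedding.refl (· ≤ ·)) n := by
    refine Finsupp.lhom_ext' fun s => LinearMap.ext_ring ?_
    simp only [LinearMap.comp_apply, Finsupp.lsingle_apply, toListChains_single,
      chainsMap_single, listPush_single, List.map_ofFn]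
    by_cases h : StrictMono (f ∘ s.1)
    · rw [tupleChain, dif_pos h, toListChains_single, normalize_single_of_pairwise]
      · rfl
      · exact List.pairwise_ofFn.2 fun _ _ hij => h hij
    · rw [tupleChain, dif_neg h, map_zero, normalize_single_of_not_pairwise]
      exact fun h' => h fun i j hij => List.pairwise_ofFn.1 h' hij
  exact congr($this c)

/-- A cycle of `C_•(S, ℤ)` is a list chain whose boundary is a multiple of the empty list. -/
theorem d_eq_zero_iff (k : ℕ) (c : Chains S k) :
    (chainComplex S).d k (k - 1) c = 0 ↔
      bd (toListChains e k c) ∈ Finsupp.supported ℤ ℤ {([] : List X)} := by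
  cases k with
  | zero =>
    refine iff_of_true ?_ (map_mem_of_mem_supported bd (fun l hl => ?_) (toListChains_mem e 0 c))
    · rw [(chainComplex S).shape _ _ (by simp)]; rfl
    · refine mem_supported_of_imp (fun l' hl' => ?_) (bd_single_mem l)
      have h1 := hl.2
      have h2 := hl'.2
      exact List.length_eq_zero_iff.1 (by omega)
  | succ k =>
    have h0 : (chainComplex S).d (k + 1) (k + 1 - 1) c = boundary S k c := chainComplex_d_apply k c
    refine Iff.trans (b := boundary S k c = (0 : Chains S k))
      (Iff.of_eq (congrArg (fun x : Chains S k => x = 0) h0)) ?_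
    rw [bd_toListChains]
    constructor
    · intro h; rw [h, map_zero]; exact zero_mem _
    · intro h
      have hd : Disjoint {l : List X | (l.Pairwise (· < ·) ∧ ∀ x ∈ l, x ∈ Set.range e) ∧
          l.length = k + 1} {[]} := by
        rw [Set.disjoint_singleton_right]
        rintro ⟨-, h⟩
        simp at h
      have := (Finsupp.disjoint_supported_supported (M := ℤ) (R := ℤ) hd).le_bot
        ⟨toListChains_mem e k (boundary S k c), h⟩
      exact toListChains_injective e k (by rw [(Submodule.mem_bot ℤ).1 this, map_zero])

/-- The augmented complex of an `m`-acyclic poset is exact up to lists of length `m + 1`. -/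
theorem IsAcyclic.exists_bd_eq {m : ℤ} (h : IsAcyclic S m) (p : ℕ) (hp : (p : ℤ) ≤ m + 1)
    (c : ListChains X) (hc : c ∈ Finsupp.supported ℤ ℤ
      {l : List X | (l.Pairwise (· < ·) ∧ ∀ x ∈ l, x ∈ Set.range e) ∧ l.length = p})
    (hb : bd c = 0) :
    ∃ w ∈ Finsupp.supported ℤ ℤ {l : List X |
      (l.Pairwise (· < ·) ∧ ∀ x ∈ l, x ∈ Set.range e) ∧ l.length = p + 1}, bd w = c := by
  cases p with
  | zero =>
    obtain ⟨x⟩ := (h (by omega)).1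
    refine ⟨consMap (e x) c, map_mem_of_mem_supported _ (fun l hl => ?_) hc, ?_⟩
    · obtain rfl := List.length_eq_zero_iff.1 hl.2
      rw [consMap_single]
      exact single_one_mem_supported ⟨⟨List.pairwise_singleton _ _, by simp⟩, rfl⟩
    · rw [bd_consMap, hb, map_zero, sub_zero]
  | succ k =>
    obtain ⟨c, rfl⟩ := exists_toListChains_eq e hc
    suffices hpt : chainsMap (OrderHom.const S PUnit.unit.{u + 1}) k c = 0 by
      obtain ⟨w, hw⟩ := h.exists_boundary_eq k (by omega) c
        ((d_eq_zero_iff e k c).2 (by rw [hb]; exact zero_mem _)) hpt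
      exact ⟨toListChains e (k + 1) w, toListChains_mem e _ w, by rw [bd_toListChains, hw]⟩
    cases k with
    | zero =>
      -- In degree zero, `bd` is the augmentation, which is the map to the chains of a point.
      have haug : (chainsMap (OrderHom.const S PUnit.unit.{u + 1}) 0) =
          (Finsupp.linearCombination ℤ fun _ : List X =>
            tupleChain fun _ : Fin 1 => PUnit.unit.{u + 1}) ∘ₗ bd ∘ₗ toListChains e 0 := by
        refine Finsupp.lhom_ext' fun s => LinearMap.ext_ring ?_
        simp [chainsMap_single, toListChains_single, bd_single_cons]
      rw [haug, LinearMap.comp_apply, LinearMap.comp_apply, hb, map_zero]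
    | succ k =>
      have hzero : chainsMap (OrderHom.const S PUnit.unit.{u + 1}) (k + 1) = 0 := by
        refine Finsupp.lhom_ext' fun s => LinearMap.ext_ring ?_
        simp only [LinearMap.comp_apply, Finsupp.lsingle_apply, chainsMap_single,
          LinearMap.zero_apply]
        rw [tupleChain, dif_neg]
        intro hs
        exact lt_irrefl PUnit.unit.{u + 1} (hs (Fin.zero_lt_one (n := k)))
      rw [hzero, LinearMap.zero_apply]

end Comparison

end PosetHomology

open PosetHomology in
theorem theorem3p5 {X Y : Type u} [PartialOrder X] [PartialOrder Y] (f : X →o Y)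
    (ht : Y → ℕ) (hht : StrictMono ht) (n : ℤ)
    (hlink : ∀ y : Y, PosetHomology.IsAcyclic (PosetHomology.linkAbove y) (n - (ht y : ℤ) - 2))
    (hfiber : ∀ y : Y, PosetHomology.IsAcyclic (PosetHomology.fiberBelow f y) ((ht y : ℤ) - 1))
    (k : ℕ) (hk : (k : ℤ) ≤ n - 1) :
    CategoryTheory.IsIso (PosetHomology.homologyMap f k) := by
  obtain ⟨N, rfl⟩ : ∃ N : ℕ, n = N := ⟨n.toNat, by omega⟩
  have hh : ∀ y, _ := fun y => exists_contraction (fiberLists f y)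
    (fun a ha l hl => ⟨ha.1.sublist hl, fun x hx => ha.2 x (hl.subset hx)⟩) (ht y + 1)
    (fun p hp c hc hb => by
      have := (hfiber y).exists_bd_eq (OrderEmbedding.subtype _) p (by omega) c
      simp only [OrderEmbedding.coe_subtype, Subtype.range_coe_subtype] at this
      exact this hc hb)
  have hg : ∀ y, _ := fun y => exists_contraction (linkLists y)
    (fun b hb l hl => ⟨hb.1.sublist hl, fun x hx => hb.2 x (hl.subset hx)⟩) (N - ht y)
    (fun p hp c hc hb => by
      have := (hlink y).exists_bd_eq (OrderEmbedding.subtype _) p (by omega) c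
      simp only [OrderEmbedding.coe_subtype, Subtype.range_coe_subtype] at this
      exact this hc hb)
  choose h hmem hcon using hh
  choose g gmem gcon using hg
  -- Cycles of the cylinder modulo `X`, with at most `N + 1` elements, come from chains of `X`.
  have key : ∀ j ≤ N + 1, ∀ c ∈ Finsupp.supported ℤ ℤ (cylinderPairs f j),
      joinBd c ∈ Finsupp.supported ℤ ℤ {q : List X × List Y | q.2 = []} →
      ∃ w ∈ Finsupp.supported ℤ ℤ (cylinderPairs f (j + 1)),
        ∃ u ∈ Finsupp.supported ℤ ℤ {a : List X | (a, []) ∈ cylinderPairs f j},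
          pair u (Finsupp.single [] 1) = c - joinBd w := by
    intro j hj c hc hcb
    obtain ⟨w, hw, hcw⟩ := exists_sub_joinBd_mem hht hmem hcon gmem
      (fun y b hb hlen => gcon y b hb (by omega)) hj hc hcb
    exact ⟨w, hw, exists_pair_nil_eq hcw⟩
  have hX : ∀ j, ∀ u ∈ Finsupp.supported ℤ ℤ {a : List X | (a, []) ∈ cylinderPairs f (j + 1)},
      ∃ u' : Chains X j, toListChains (RelEmbedding.refl (· ≤ ·)) j u' = u := fun j u hu =>
    exists_toListChains_eq _ (mem_supported_of_imp
      (fun a ha => by exact ⟨⟨ha.1, fun x _ => ⟨x, rfl⟩⟩, by simpa using ha.2.2.2⟩) hu)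
  have hY : ∀ j (z : Chains Y j), pair (Finsupp.single ([] : List X) 1)
      (toListChains (RelEmbedding.refl (· ≤ ·)) j z) ∈
        Finsupp.supported ℤ ℤ (cylinderPairs f (j + 1)) := fun j z =>
    pair_mem (s := {[]}) (by
      rintro _ rfl b ⟨⟨hb, -⟩, hlen⟩
      exact ⟨List.Pairwise.nil, hb, by simp, by simpa using hlen⟩) (single_one_mem_supported rfl)
      (toListChains_mem _ j z)
  refine isIso_homologyMap f k ?_ ?_
  · -- Surjectivity: deform a cycle `z` of `Y` inside the cylinder into `X`, then retract to `Y`.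
    intro z hz
    have hz' := (d_eq_zero_iff (RelEmbedding.refl (· ≤ ·)) k z).1 hz
    obtain ⟨w, hw, u, hu, huw⟩ := key (k + 1) (by omega) _ (hY k z) (by
      rw [joinBd_pair_nil_left]
      exact pair_mem (s := {[]}) (fun a _ b hb => hb) (single_one_mem_supported rfl) hz')
    obtain ⟨x, rfl⟩ := hX k u hu
    obtain ⟨v, hv⟩ := exists_toListChains_eq (n := k + 1) (RelEmbedding.refl (· ≤ ·))
      (mem_supported_of_imp (fun l hl => by exact ⟨⟨hl.1, fun y _ => ⟨y, rfl⟩⟩, hl.2⟩)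
        (retract_mem f hw))
    refine ⟨x, (d_eq_zero_iff (RelEmbedding.refl (· ≤ ·)) k x).2 ?_, -v, ?_⟩
    · have := congrArg (Finsupp.lmapDomain ℤ ℤ Prod.fst) (congrArg joinBd huw)
      rw [joinBd_pair_nil_right, lmapDomain_fst_pair_nil_right, map_sub, joinBd_joinBd, sub_zero,
        joinBd_pair_nil_left] at this
      rw [this]
      refine map_mem_of_mem_supported (s := {([], [])}) _ ?_ (pair_mem ?_
        (single_one_mem_supported (Set.mem_singleton _)) hz')
      · rintro _ rfl
        rw [Finsupp.lmapDomain_apply, Finsupp.mapDomain_single]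
        exact single_one_mem_supported rfl
      · rintro _ rfl _ rfl
        rfl
    · have := congrArg (retract f) huw
      rw [retract_pair_nil_right, map_sub, retract_joinBd f hw, retract_pair_nil_left, ← hv,
        bd_toListChains, ← toListChains_chainsMap, normalize_eq_self
          (mem_supported_of_imp (fun l hl => hl.1.1) (toListChains_mem _ k z)), ← map_sub] at this
      have := toListChains_injective _ _ this
      rw [this, map_neg]
      abel
  · -- Injectivity: if `f w = ∂ v`, then `v` and the prism on `w` together bound `w` in the cylinder,
    -- and the bounding chain is a relative cycle, which can be deformed into `X`.
    intro w hw v hv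
    have hw' := (d_eq_zero_iff (RelEmbedding.refl (· ≤ ·)) k w).1 hw
    have hwmem := toListChains_mem (RelEmbedding.refl (· ≤ ·)) k w
    have hprism : joinBd (prism f (toListChains (RelEmbedding.refl (· ≤ ·)) k w)) =
        pair (Finsupp.single [] 1) (listPush f (toListChains (RelEmbedding.refl (· ≤ ·)) k w)) -
          pair (toListChains (RelEmbedding.refl (· ≤ ·)) k w) (Finsupp.single [] 1) := by
      have h1 := eqOn_of_mem_supported (φ := joinBd ∘ₗ prism f + prism f ∘ₗ bd)
        (ψ := pair (Finsupp.single [] 1) ∘ₗ listPush f - pair.flip (Finsupp.single [] 1))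
        (fun l hl => by simpa using joinBd_prism_single f hl.1.1) hwmem
      have h2 : prism f (bd (toListChains (RelEmbedding.refl (· ≤ ·)) k w)) = 0 :=
        eqOn_of_mem_supported (ψ := 0) (by rintro _ rfl; simp [prism_single_nil]) hw'
      simpa [h2] using h1
    have hc : joinBd (pair (Finsupp.single [] 1)
        (toListChains (RelEmbedding.refl (· ≤ ·)) (k + 1) v) -
          prism f (toListChains (RelEmbedding.refl (· ≤ ·)) k w)) =
        pair (toListChains (RelEmbedding.refl (· ≤ ·)) k w) (Finsupp.single [] 1) := by
      rw [map_sub, joinBd_pair_nil_left, hprism, bd_toListChains, hv, toListChains_chainsMap]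
      abel
    obtain ⟨w', hw'mem, u, hu, huw⟩ := key (k + 2) (by omega) _
      (Submodule.sub_mem _ (hY (k + 1) v) (map_mem_of_mem_supported (prism f) (fun l hl => by
        have := prism_single_mem f hl.1.1
        rw [hl.2] at this
        exact mem_supported_of_imp (fun q hq => hq.1) this) hwmem)) (by
      rw [hc]
      exact pair_mem (s := Set.univ) (t := {[]}) (fun a _ b hb => hb) (by simp)
        (single_one_mem_supported rfl))
    obtain ⟨x, rfl⟩ := hX (k + 1) u hu
    refine ⟨x, ?_⟩
    apply toListChains_injective (RelEmbedding.refl (· ≤ ·))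
    have := congrArg (Finsupp.lmapDomain ℤ ℤ Prod.fst) (congrArg joinBd huw)
    rwa [map_sub joinBd, joinBd_joinBd, sub_zero, hc, joinBd_pair_nil_right, bd_toListChains,
      lmapDomain_fst_pair_nil_right, lmapDomain_fst_pair_nil_right] at this
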